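/- **Theorem (quasicoherent modules satisfy descent for faithfully flat presentations).** Statements of type theory about sets are read in a topos of sheaves $\mathrm{Sh}(C,J)$ on an arbitrary small site, by Kripke–Joyal semantics: a type at stage $V\in C$ is a sheaf on the slice site $C/V$, "for all" ranges over all later stages $V'\to V$, "there merely exists" means existence on a covering sieve, equality of types is isomorphism, and all algebras, tensor products, function types $M^X$ and exactness statements are internal. Let $R$ be a commutative ring object. For a finitely presented $R$-algebra $A$ (one that is merely of the form $R[x_1,\dots,x_n]/(p_1,\dots,p_m)$) put $\mathrm{Spec}(A)=\mathrm{Hom}_{R\text{-alg}}(A,R)$. Assume the axioms of synthetic algebraic geometry: for every finitely presented $R$-algebra $A$, 1. (Blechschmidt duality) the map $A\to R^{\mathrm{Spec}(A)}$, $a\mapsto(\varphi\mapsto\varphi(a))$, is bijective; 2. $\mathrm{Spec}(A)$ is projective: every surjection onto it merely has a section; 3. the diagonal map $\mathbb N\to\mathbb N^{\mathrm{Spec}(A)}$ is bijective. Let $T$ be a presentation, i.e. a collection of types with $1\in T$ that is closed under $\Sigma$: if $X\in T$ and $B(x)\in T$ for all $x:X$, then $\sum_{x:X}B(x)\in T$.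 Suppose that every $X\in T$ is merely isomorphic to a finite sum $\mathrm{Spec}(A_1)+\dots+\mathrm{Spec}(A_n)$ of spectra of finitely presented $R$-algebras such that $A_1\times\dots\times A_n$ is faithfully flat over $R$, i.e. tensoring with it preserves and reflects exactness of complexes $N_1\to N_2\to N_3$ of $R$-modules. Let $M$ be a quasicoherent $R$-module, i.e. for every finitely presented $R$-algebra $A$ the canonical map $M\otimes_R A\to M^{\mathrm{Spec}(A)}$, $m\otimes a\mapsto(\varphi\mapsto\varphi(a)m)$, is bijective. Then $M$ satisfies descent for $T$: for every $X\in T$ the sequence $$M^X\xrightarrow{\;d\;}M^{X\times X}\xrightarrow{\;d\;}M^{X\times X\times X},$$ $$d(b)(x,x')=b(x)-b(x'),\qquad d(c)(x,x',x'')=c(x,x')-c(x,x'')+c(x',x''),$$ is exact (in the middle). -/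

import Mathlib

open CategoryTheory Opposite Limits

universe u v

namespace InternalSAG

noncomputable section

/-! # Internal algebra in the topos of sheaves on a small site

Type-theoretic statements about sets are read in the topos of sheaves on a small site `(C, J)` by
the Kripke-Joyal semantics.  A type *at stage* `V : C` is a sheaf on `Over V`; a statement that
begins with "for all" is tested at all later stages `V' ⟶ V`, and "there merely exists" means
"exists on a covering sieve".  Univalent equality of types is isomorphism.

Presheaves are used to represent their associated sheaves: a map of presheaves is read as
bijective if it is locally bijective, i.e. if the map of associated sheaves is an isomorphism.

Since the site is arbitrary, it may be replaced by a slice `Over U`; global data on the slice are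
the data at stage `U`. -/

/-! ## Restriction of scalars and presheaves of modules -/

section Scalars

variable {k S S' : Type u} [CommRing k] [CommRing S] [CommRing S']

/-- The `S`-module `M` regarded as a `k`-module through `ρ : k →+* S`. -/
def Restr (_ρ : k →+* S) (M : Type u) : Type u := M

instance (ρ : k →+* S) (M : Type u) [AddCommGroup M] : AddCommGroup (Restr ρ M) :=
  inferInstanceAs (AddCommGroup M)

instance (ρ : k →+* S) (M : Type u) [AddCommGroup M] [Module S M] : Module k (Restr ρ M) :=
  Module.compHom M ρ

end Scalars

/-- Presheaves of modules over a presheaf of commutative rings. -/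
abbrev ModPresheaf {D : Type u} [Category.{u} D] (O : Dᵒᵖ ⥤ CommRingCat.{u}) :=
  PresheafOfModules.{u} (O ⋙ forget₂ CommRingCat.{u} RingCat.{u})

section Tensor

variable {D : Type u} [Category.{u} D] {O : Dᵒᵖ ⥤ CommRingCat.{u}}

/-- Restriction of sections of a presheaf of modules. -/
def res (N : ModPresheaf O) {d d' : D} (f : d' ⟶ d) : N.obj (op d) →+ N.obj (op d') :=
  (N.restrictₛₗ f.op).toAddMonoidHom

theorem res_smul (N : ModPresheaf O) {d d' : D} (f : d' ⟶ d) (r : O.obj (op d))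
    (n : N.obj (op d)) : res N f (r • n) = O.map f.op r • res N f n :=
  (N.restrictₛₗ f.op).map_smulₛₗ r n

variable {k : Type u} [CommRing k]

/-- The sections over `d` of the presheaf `N ⊗ₖ B`, where `ρ : k →+* O(d)` makes `N(d)` a
`k`-module. -/
abbrev Tens (N : ModPresheaf O) {d : D} (ρ : k →+* O.obj (op d)) (B : Type u) [AddCommGroup B]
    [Module k B] : Type u :=
  TensorProduct k (Restr ρ (N.obj (op d))) B

/-- The restriction map of `N ⊗ₖ B` along `f : d' ⟶ d`. -/
def tensRes (N : ModPresheaf O) {d d' : D} (f : d' ⟶ d) (ρ : k →+* O.obj (op d))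
    (B : Type u) [AddCommGroup B] [Module k B] :
    Tens N ρ B →ₗ[k] Tens N ((O.map f.op).hom.comp ρ) B :=
  LinearMap.rTensor B
    ({ toFun := fun n => res N f n
       map_add' := fun a b => map_add (res N f) a b
       map_smul' := fun r n => res_smul N f (ρ r) n } :
      Restr ρ (N.obj (op d)) →ₗ[k] Restr ((O.map f.op).hom.comp ρ) (N.obj (op d')))

/-- The map `N(d) ⊗ₖ B → N'(d) ⊗ₖ B` induced by a map of presheaves of modules. -/
def tensMap {N N' : ModPresheaf O} (φ : N ⟶ N') {d : D} (ρ : k →+* O.obj (op d))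
    (B : Type u) [AddCommGroup B] [Module k B] : Tens N ρ B →ₗ[k] Tens N' ρ B :=
  LinearMap.rTensor B
    ({ toFun := fun n => (φ.app (op d)).hom n
       map_add' := fun a b => map_add (φ.app (op d)).hom a b
       map_smul' := fun r n => LinearMap.map_smul (φ.app (op d)).hom (ρ r)
        (show N.obj (op d) from n) } :
      Restr ρ (N.obj (op d)) →ₗ[k] Restr ρ (N'.obj (op d)))

end Tensor

section Geometry

variable {C : Type u} [SmallCategory C] {J : GrothendieckTopology C}

/-! ## Faithful flatness -/

section Exactness

variable {D : Type u} [Category.{u} D] {O : Dᵒᵖ ⥤ CommRingCat.{u}}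

/-- Exactness of the complex `N₁ ⟶ N₂ ⟶ N₃` after passage to associated sheaves: an element of
the kernel lies in the image locally. -/
def LocallyExact (K : GrothendieckTopology D) {N₁ N₂ N₃ : ModPresheaf O}
    (φ : N₁ ⟶ N₂) (ψ : N₂ ⟶ N₃) : Prop :=
  ∀ (d : D) (y : N₂.obj (op d)), (ψ.app (op d)).hom y = 0 →
    ∃ S ∈ K d, ∀ (d' : D) (f : d' ⟶ d), S f →
      ∃ x : N₁.obj (op d'), (φ.app (op d')).hom x = res N₂ f y

/-- Exactness of `N₁ ⊗ₖ B ⟶ N₂ ⊗ₖ B ⟶ N₃ ⊗ₖ B` after passage to associated sheaves, where `ρ`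
makes `O` a presheaf of `k`-algebras. -/
def LocallyExactTens (K : GrothendieckTopology D) {N₁ N₂ N₃ : ModPresheaf O}
    (φ : N₁ ⟶ N₂) (ψ : N₂ ⟶ N₃) {k : Type u} [CommRing k] (ρ : ∀ d : D, k →+* O.obj (op d))
    (B : Type u) [AddCommGroup B] [Module k B] : Prop :=
  ∀ (d : D) (y : Tens N₂ (ρ d) B), tensMap ψ (ρ d) B y = 0 →
    ∃ S ∈ K d, ∀ (d' : D) (f : d' ⟶ d), S f →
      ∃ x : Tens N₁ ((O.map f.op).hom.comp (ρ d)) B, tensMap φ _ B x = tensRes N₂ f (ρ d) B y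

end Exactness

variable (R : Sheaf J CommRingCat.{u})

/-- An `R(V)`-algebra `B` represents the internal `R`-algebra at stage `V` associated to
`W ↦ R(W) ⊗ B`.  It is (internally) *faithfully flat* if at every later stage `V'`, tensoring a
complex `N₁ ⟶ N₂ ⟶ N₃` of `R`-modules at stage `V'` with `B` preserves and reflects exactness.
The modules are given by presheaves that represent their associated sheaves; exactness and the
tensor product depend on the associated sheaves only. -/
def IsFaithfullyFlat (V : C) (B : Type u) [CommRing B] [Algebra (R.obj.obj (op V)) B] : Prop :=
  ∀ (V' : C) (h : V' ⟶ V) (N₁ N₂ N₃ : ModPresheaf ((Over.forget V').op ⋙ R.obj))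
    (φ : N₁ ⟶ N₂) (ψ : N₂ ⟶ N₃), φ ≫ ψ = 0 →
    (LocallyExact (J.over V') φ ψ ↔
      LocallyExactTens (J.over V') φ ψ (fun W => (R.obj.map (W.hom ≫ h).op).hom) B)

/-! ## Spectra

Internal finitely presented algebras at stage `V` are locally given by finitely many generators
and relations over the ring of sections of `R`, i.e. locally represented by finitely presented
`R(V)`-algebras `A`. -/

/-- The spectrum at stage `V` of the internal algebra represented by `A`, the type of algebra
homomorphisms to `R`: its elements over `W ⟶ V` are the `R(V)`-algebra homomorphisms
`A → R(W)`. -/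
abbrev Spec (V : C) (A : Type u) [CommRing A] [Algebra (R.obj.obj (op V)) A] :
    (Over V)ᵒᵖ ⥤ Type u where
  obj W := { φ : A →+* R.obj.obj (op W.unop.left) //
    φ.comp (algebraMap (R.obj.obj (op V)) A) = (R.obj.map W.unop.hom.op).hom }
  map f := ↾fun φ => ⟨(R.obj.map f.unop.left.op).hom.comp φ.1, by
    rw [RingHom.comp_assoc, φ.2, ← CommRingCat.hom_comp, ← R.obj.map_comp, ← op_comp, Over.w]⟩
  map_id W := by
    ext φ
    simp
  map_comp f g := by
    ext φ
    simp

/-- Restriction of a type (presheaf) at stage `V` to a later stage `V' ⟶ V`. -/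
abbrev restr {V V' : C} (h : V' ⟶ V) (X : (Over V)ᵒᵖ ⥤ Type u) : (Over V')ᵒᵖ ⥤ Type u :=
  (Over.map h).op ⋙ X

/-! ## Function modules -/

/-- Sheaves of modules over the sheaf of rings `R`: the internal `R`-modules. -/
abbrev Modules := SheafOfModules.{u} ((sheafCompose J (forget₂ CommRingCat.{u} RingCat.{u})).obj R)

variable {R}

/-- The presheaf of modules underlying a sheaf of modules. -/
abbrev Modules.pre (M : Modules R) : ModPresheaf R.obj := M.val

/-- The elements at stage `V` of the group `M ^ X` of functions from `X` to `M`. -/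
def Maps {V : C} (X : (Over V)ᵒᵖ ⥤ Type u) (M : Modules R) :
    AddSubgroup (∀ W : Over V, X.obj (op W) → M.pre.obj (op W.left)) where
  carrier := { s | ∀ (W W' : Over V) (f : W' ⟶ W) (x : X.obj (op W)),
    s W' (X.map f.op x) = res M.pre f.left (s W x) }
  add_mem' ha hb W W' f x := by
    simp only [Pi.add_apply, map_add, ha W W' f x, hb W W' f x]
  zero_mem' W W' f x := by simp
  neg_mem' ha W W' f x := by
    simp only [Pi.neg_apply, map_neg, ha W W' f x]

/-- Restriction of functions `X → M` to a later stage. -/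
def Maps.restrict {V V' : C} {X : (Over V)ᵒᵖ ⥤ Type u} {M : Modules R} (h : V' ⟶ V)
    (s : Maps X M) : Maps (restr h X) M :=
  ⟨fun W x => s.1 ((Over.map h).obj W) x, fun _ _ f x => s.2 _ _ ((Over.map h).map f) x⟩

/-! ## Quasicoherent modules -/

/-- The map `M(V) ⊗ A → M(W)`, `m ⊗ a ↦ φ(a) • m`, attached to an algebra homomorphism
`φ : A → R(W)`, where `f : W ⟶ V` and `ρ` makes `M(V)` a `k`-module. -/
def tensEval (M : Modules R) {V W : C} {k : Type u} [CommRing k] (ρ : k →+* R.obj.obj (op V))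
    (A : Type u) [CommRing A] [Algebra k A] (f : W ⟶ V) (φ : A →+* R.obj.obj (op W))
    (hφ : φ.comp (algebraMap k A) = (R.obj.map f.op).hom.comp ρ) :
    Tens M.pre ρ A →+ M.pre.obj (op W) :=
  TensorProduct.liftAddHom
    ({ toFun := fun m =>
        { toFun := fun a => φ a • res M.pre f m
          map_zero' := by simp
          map_add' := fun a b => by rw [map_add, add_smul] }
       map_zero' := by
        ext a
        exact (congrArg (φ a • ·) (map_zero (res M.pre f))).trans (smul_zero _)
       map_add' := fun m n => by
        ext a
        exact (congrArg (φ a • ·) (map_add (res M.pre f) m n)).trans (smul_add _ _ _) } :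
      Restr ρ (M.pre.obj (op V)) →+ A →+ M.pre.obj (op W))
    (fun r m a => by
      have h1 : φ (algebraMap k A r) = R.obj.map f.op (ρ r) := RingHom.congr_fun hφ r
      have h2 := res_smul M.pre f (ρ r) m
      change φ a • res M.pre f (ρ r • (show M.pre.obj (op V) from m)) = φ (r • a) • res M.pre f m
      rw [h2, Algebra.smul_def, map_mul, h1, smul_smul, mul_comm])

/-- The functions `φ ↦ φ(a) • m` are natural in the stage, so that `tensEval` gives a map
`M ⊗ A → M ^ Spec(A)`. -/
theorem res_tensEval (M : Modules R) {V W W' : C} {k : Type u} [CommRing k]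
    (ρ : k →+* R.obj.obj (op V)) (A : Type u) [CommRing A] [Algebra k A] (f : W ⟶ V)
    (φ : A →+* R.obj.obj (op W))
    (hφ : φ.comp (algebraMap k A) = (R.obj.map f.op).hom.comp ρ) (g : W' ⟶ W)
    (hg : ((R.obj.map g.op).hom.comp φ).comp (algebraMap k A) =
      (R.obj.map (g ≫ f).op).hom.comp ρ) (t : Tens M.pre ρ A) :
    res M.pre g (tensEval M ρ A f φ hφ t) =
      tensEval M ρ A (g ≫ f) ((R.obj.map g.op).hom.comp φ) hg t := by
  induction t using TensorProduct.induction_on with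
  | zero => simp only [map_zero]
  | add x y hx hy => simp only [map_add, hx, hy]
  | tmul m a =>
    change res M.pre g (φ a • res M.pre f m) = R.obj.map g.op (φ a) • res M.pre (g ≫ f) m
    rw [res_smul]
    congr 1
    exact (M.pre.map_comp_apply f.op g.op m).symm

/-- A module `M` is *quasicoherent* if for every finitely presented `R`-algebra `A` (at any stage
`V`) the canonical map `M ⊗ A → M ^ Spec(A)`, `m ⊗ a ↦ (φ ↦ φ(a) • m)`, is bijective, i.e. at every
later stage `V'` it is locally injective and locally surjective. -/
def IsQuasicoherent (M : Modules R) : Prop :=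
  ∀ (V : C) (A : Type u) [CommRing A] [Algebra (R.obj.obj (op V)) A],
    Algebra.FinitePresentation (R.obj.obj (op V)) A → ∀ (V' : C) (h : V' ⟶ V),
      (∀ t : Tens M.pre (R.obj.map h.op).hom A,
        (∀ (W : Over V') (φ : (restr h (Spec R V A)).obj (op W)),
          tensEval M (R.obj.map h.op).hom A W.hom φ.1
            (by rw [φ.2, ← CommRingCat.hom_comp, ← R.obj.map_comp]; rfl) t = 0) →
        ∃ S ∈ J V', ∀ (V'' : C) (f : V'' ⟶ V'), S f →
          tensRes M.pre f (R.obj.map h.op).hom A t = 0) ∧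
      (∀ s : Maps (restr h (Spec R V A)) M,
        ∃ S ∈ J V', ∀ (V'' : C) (f : V'' ⟶ V'), S f →
          ∃ t : Tens M.pre ((R.obj.map f.op).hom.comp (R.obj.map h.op).hom) A,
            ∀ (W : Over V'') (φ : (restr f (restr h (Spec R V A))).obj (op W)),
              tensEval M ((R.obj.map f.op).hom.comp (R.obj.map h.op).hom) A W.hom φ.1
                (by
                  rw [φ.2, ← RingHom.comp_assoc]
                  simp only [← CommRingCat.hom_comp, ← R.obj.map_comp]
                  simp) t = (Maps.restrict f s).1 W φ)

/-! ## The axioms of synthetic algebraic geometry -/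

/-- A type at stage `V` is *projective* if at every later stage `V'`, every surjection from a type
onto it merely has a section. -/
def IsProjectiveType (J : GrothendieckTopology C) {V : C} (X : (Over V)ᵒᵖ ⥤ Type u) : Prop :=
  ∀ (V' : C) (h : V' ⟶ V) (Y : Sheaf (J.over V') (Type u)) (p : Y.obj ⟶ restr h X),
    Presheaf.IsLocallySurjective (J.over V') p →
      ∃ S ∈ J V', ∀ (V'' : C) (f : V'' ⟶ V'), S f →
        ∃ σ : restr f (restr h X) ⟶ restr f Y.obj,
          σ ≫ Functor.whiskerLeft (Over.map f).op p = 𝟙 _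

/-- The type of natural numbers: the constant sheaf. -/
def natSheaf (J : GrothendieckTopology C) : Sheaf J (Type u) :=
  (constantSheaf J (Type u)).obj (ULift.{u} ℕ)

/-- The axioms of synthetic algebraic geometry for the ring `R`. -/
structure IsSyntheticAG (R : Sheaf J CommRingCat.{u}) : Prop where
  /-- Duality: for every finitely presented `R`-algebra `A = R ⊗ A`, the canonical map
  `A → R ^ Spec(A)`, `a ↦ (φ ↦ φ(a))`, is bijective. -/
  duality : IsQuasicoherent (SheafOfModules.unit _ : Modules R)
  /-- Spectra of finitely presented algebras are projective. -/
  projective : ∀ (V : C) (A : Type u) [CommRing A] [Algebra (R.obj.obj (op V)) A],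
    Algebra.FinitePresentation (R.obj.obj (op V)) A → IsProjectiveType J (Spec R V A)
  /-- Every map from the spectrum of a finitely presented algebra to the natural numbers is
  constant, with a unique value. -/
  constancy : ∀ (V : C) (A : Type u) [CommRing A] [Algebra (R.obj.obj (op V)) A],
    Algebra.FinitePresentation (R.obj.obj (op V)) A → ∀ (V' : C) (h : V' ⟶ V)
      (s : restr h (Spec R V A) ⟶ (Over.forget V').op ⋙ (natSheaf J).obj),
      ∃! n : (natSheaf J).obj.obj (op V'), ∀ (W : Over V')
        (x : (restr h (Spec R V A)).obj (op W)), s.app (op W) x = (natSheaf J).obj.map W.hom.op n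

/-! ## Presentations -/

/-- A *presentation*: a collection `T` of types containing `1` and closed under `Σ`.  A collection
of types is given by its membership predicate, a proposition about types; it is therefore a class
of types at each stage which is invariant under isomorphism, stable under passage to later stages,
and local. -/
structure Presentation (J : GrothendieckTopology C) where
  /-- `X ∈ T`, at stage `V` -/
  mem : ∀ {V : C}, Sheaf (J.over V) (Type u) → Prop
  mem_of_iso : ∀ {V : C} {X Y : Sheaf (J.over V) (Type u)}, (X ≅ Y) → mem X → mem Y
  mem_restrict : ∀ {V V' : C} (h : V' ⟶ V) (X : Sheaf (J.over V) (Type u)),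
    mem X → mem ((J.overMapPullback (Type u) h).obj X)
  mem_of_cover : ∀ {V : C} (X : Sheaf (J.over V) (Type u)) (S : Sieve V), S ∈ J V →
    (∀ (V' : C) (h : V' ⟶ V), S h → mem ((J.overMapPullback (Type u) h).obj X)) → mem X
  /-- `1 ∈ T` -/
  one_mem : ∀ V : C, mem (⊤_ Sheaf (J.over V) (Type u))
  /-- If `X ∈ T` and `B : X → 𝒰` has `B(x) ∈ T` for all `x : X`, then `Σ (x : X), B(x) ∈ T`.  The
  family `B` is given by the projection `p` from `Y = Σ (x : X), B(x)`, with fibres `B(x)`. -/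
  sigma_mem : ∀ {V : C} (X Y : Sheaf (J.over V) (Type u)) (p : Y ⟶ X), mem X →
    (∀ (V' : C) (h : V' ⟶ V)
      (x : (⊤_ Sheaf (J.over V') (Type u)) ⟶ (J.overMapPullback (Type u) h).obj X),
      mem (pullback ((J.overMapPullback (Type u) h).map p) x)) → mem Y

/-- The disjoint union of finitely many presheaves. -/
abbrev sumPresheaf {D : Type u} [Category.{u} D] {n : ℕ} (F : Fin n → Dᵒᵖ ⥤ Type u) :
    Dᵒᵖ ⥤ Type u where
  obj W := Σ i, (F i).obj W
  map f := ↾fun x => ⟨x.1, (F x.1).map f x.2⟩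
  map_id W := by
    apply ConcreteCategory.hom_ext
    rintro ⟨i, x⟩
    simp
  map_comp f g := by
    apply ConcreteCategory.hom_ext
    rintro ⟨i, x⟩
    simp

/-- The type `X` at stage `V` merely is a sum `Spec(A₁) + ⋯ + Spec(Aₙ)` of spectra of finitely
presented algebras for which `A₁ × ⋯ × Aₙ` is faithfully flat over `R`. -/
def IsFaithfullyFlatAffineSum (R : Sheaf J CommRingCat.{u}) {V : C}
    (X : Sheaf (J.over V) (Type u)) : Prop :=
  ∃ S ∈ J V, ∀ (V' : C) (h : V' ⟶ V), S h →
    ∃ (n : ℕ) (A : Fin n → Type u) (_ : ∀ i, CommRing (A i))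
      (_ : ∀ i, Algebra (R.obj.obj (op V')) (A i)),
      (∀ i, Algebra.FinitePresentation (R.obj.obj (op V')) (A i)) ∧
      IsFaithfullyFlat R V' (∀ i, A i) ∧
      ∃ ι : sumPresheaf (fun i => Spec R V' (A i)) ⟶ restr h X.obj,
        Presheaf.IsLocallyInjective (J.over V') ι ∧ Presheaf.IsLocallySurjective (J.over V') ι

/-! ## Descent -/

section Descent

variable {V : C}

/-- The product of two types at stage `V`. -/
abbrev prodType (X Y : (Over V)ᵒᵖ ⥤ Type u) : (Over V)ᵒᵖ ⥤ Type u where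
  obj W := X.obj W × Y.obj W
  map f := ↾fun x => (X.map f x.1, Y.map f x.2)

/-- `d : M ^ X → M ^ (X × X)`, `d(b)(x, x') = b(x) - b(x')`. -/
def d₀ (X : (Over V)ᵒᵖ ⥤ Type u) (M : Modules R) : Maps X M →+ Maps (prodType X X) M where
  toFun b := ⟨fun W x => b.1 W x.1 - b.1 W x.2, fun W W' f x =>
    (congrArg₂ (· - ·) (b.2 W W' f x.1) (b.2 W W' f x.2)).trans
      (map_sub (res M.pre f.left) _ _).symm⟩
  map_zero' := Subtype.ext (funext fun _ => funext fun _ => sub_zero _)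
  map_add' _ _ := Subtype.ext (funext fun _ => funext fun _ => add_sub_add_comm _ _ _ _)

/-- `d : M ^ (X × X) → M ^ (X × X × X)`, `d(c)(x, x', x'') = c(x, x') - c(x, x'') + c(x', x'')`. -/
def d₁ (X : (Over V)ᵒᵖ ⥤ Type u) (M : Modules R) :
    Maps (prodType X X) M →+ Maps (prodType X (prodType X X)) M where
  toFun c := ⟨fun W x => c.1 W (x.1, x.2.1) - c.1 W (x.1, x.2.2) + c.1 W (x.2.1, x.2.2),
    fun W W' f x => by
      have h := c.2 W W' f
      have h' := congrArg₂ (· + ·) (congrArg₂ (· - ·) (h (x.1, x.2.1)) (h (x.1, x.2.2)))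
        (h (x.2.1, x.2.2))
      refine h'.trans ?_
      simp only [map_add, map_sub]⟩
  map_zero' := Subtype.ext (funext fun W => funext fun x => by
    change (0 : M.pre.obj (op W.left)) - 0 + 0 = 0
    simp)
  map_add' a b := Subtype.ext (funext fun W => funext fun x => by
    change (a.1 W (x.1, x.2.1) + b.1 W (x.1, x.2.1)) - (a.1 W (x.1, x.2.2) + b.1 W (x.1, x.2.2)) +
        (a.1 W (x.2.1, x.2.2) + b.1 W (x.2.1, x.2.2)) =
      (a.1 W (x.1, x.2.1) - a.1 W (x.1, x.2.2) + a.1 W (x.2.1, x.2.2)) +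
        (b.1 W (x.1, x.2.1) - b.1 W (x.1, x.2.2) + b.1 W (x.2.1, x.2.2))
    abel)

/-- The sequence `M ^ X → M ^ (X × X) → M ^ (X × X × X)` is exact: at every later stage, an element
of the middle group lies in the kernel if and only if it merely lies in the image. -/
def DescentSequenceExact (X : (Over V)ᵒᵖ ⥤ Type u) (M : Modules R) : Prop :=
  ∀ (V' : C) (h : V' ⟶ V) (c : Maps (prodType (restr h X) (restr h X)) M),
    d₁ (restr h X) M c = 0 ↔
      ∃ S ∈ J V', ∀ (V'' : C) (f : V'' ⟶ V'), S f →
        ∃ b : Maps (restr f (restr h X)) M,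
          d₀ (restr f (restr h X)) M b = Maps.restrict f c

end Descent

/-- The module `M` satisfies *descent* for `T` if for all `X ∈ T` the sequence
`M ^ X → M ^ (X × X) → M ^ (X × X × X)` is exact. -/
def SatisfiesDescent (T : Presentation J) (M : Modules R) : Prop :=
  ∀ (V : C) (X : Sheaf (J.over V) (Type u)), T.mem X → DescentSequenceExact X.obj M

end Geometry

end

end InternalSAG

/-! Locally `X` is `Spec A₁ + ⋯ + Spec Aₙ`; put `A = A₁ × ⋯ × Aₙ`. Since `Spec B × Spec B' = Spec (B
⊗ B')`, the powers of `X` are sums of spectra of tensor products of the `Aᵢ`, again finitely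
presented. Quasicoherence of `M` and the finiteness of the sum then identify the descent sequence
with `M ⊗ -` applied to the Amitsur complex `A → A ⊗ A → A ⊗ A ⊗ A`. By faithful flatness, exactness
of the latter may be tested after one more tensoring with `A`, where multiplying the last two
factors contracts the complex (`amitsur_homotopy`, `exists_amitsur₀_eq`).

Internally a cocycle `c` is treated as follows. The surjective half of quasicoherence represents it
locally by a tensor `t` (`exists_represents`); the injective half turns `d₁ c = 0` into local
vanishing of the Amitsur differential of `t` (`locally_amitsur₁_eq_zero`); descent gives locally `u`
with boundary `t`, and evaluating `u` at points gives `b` with `d₀ b = c`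
(`Represents.exists_d₀_eq`). Each step refines the cover. The passage from the presheaf sum of
spectra to the sheaf `X` uses that `M` is a sheaf, as does the converse inclusion: `d₁ ∘ d₀ = 0`,
and equality of functions into `M` is local. -/

namespace InternalSAG

noncomputable section

/-! ### Calculus of covering sieves -/

section Covers

variable {C : Type u} [SmallCategory C] {J : GrothendieckTopology C}

theorem exists_cover_trans {V : C} {P : ∀ V' : C, (V' ⟶ V) → Prop}
    (h : ∃ S ∈ J V, ∀ (V' : C) (f : V' ⟶ V), S f →
      ∃ S' ∈ J V', ∀ (V'' : C) (g : V'' ⟶ V'), S' g → P V'' (g ≫ f)) :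
    ∃ S ∈ J V, ∀ (V' : C) (f : V' ⟶ V), S f → P V' f := by
  obtain ⟨S, hS, h⟩ := h
  choose S' hS' h' using h
  refine ⟨Sieve.bind S.arrows fun Y f hf => S' Y f hf,
    J.bind_covering hS fun Y f hf => hS' Y f hf, ?_⟩
  rintro V' _ ⟨Z, g, f, hf, hg, rfl⟩
  exact h' Z f hf V' g hg

/-- Finiteness is essential: the common cover is an intersection of sieves, and only finite
intersections of covering sieves need be covering. -/
theorem exists_cover_forall {ι : Type*} [Finite ι] {V : C}
    {P : ι → ∀ V' : C, (V' ⟶ V) → Prop}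
    (h : ∀ i, ∃ S ∈ J V, ∀ (V' : C) (f : V' ⟶ V), S f → P i V' f) :
    ∃ S ∈ J V, ∀ (V' : C) (f : V' ⟶ V), S f → ∀ i, P i V' f := by
  classical
  cases nonempty_fintype ι
  choose S hS h using h
  have hinf : ∀ s : Finset ι, s.inf S ∈ J V := by
    intro s
    induction s using Finset.induction_on with
    | empty => exact J.top_mem V
    | insert i s _ ih =>
      rw [Finset.inf_insert]
      exact J.intersection_covering (hS i) ih
  exact ⟨Finset.univ.inf S, hinf _, fun V' f hf i =>
    h i V' f ((Finset.inf_le (Finset.mem_univ i) : Finset.univ.inf S ≤ S i) f hf)⟩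

end Covers

/-! ### Presheaves of modules of the form `N ⊗ₖ B` -/

section TensorFunctoriality

variable {D : Type u} [Category.{u} D] {O : Dᵒᵖ ⥤ CommRingCat.{u}}
  {k : Type u} [CommRing k]

theorem res_id (N : ModPresheaf O) {d : D} (n : N.obj (op d)) : res N (𝟙 d) n = n := by
  change N.presheaf.map (𝟙 (op d)) n = n
  rw [N.presheaf.map_id]
  rfl

theorem res_comp (N : ModPresheaf O) {d d' d'' : D} (g : d'' ⟶ d') (f : d' ⟶ d)
    (n : N.obj (op d)) : res N (g ≫ f) n = res N g (res N f n) :=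
  N.map_comp_apply f.op g.op n

/-- The restriction map of `N ⊗ₖ B` along `f : d' ⟶ d`, for `k`-algebra structures on `O(d)` and
`O(d')` compatible with `f`. -/
def tensResOfEq (N : ModPresheaf O) {d d' : D} (f : d' ⟶ d) (ρ : k →+* O.obj (op d))
    (ρ' : k →+* O.obj (op d')) (h : ρ' = (O.map f.op).hom.comp ρ)
    (B : Type u) [AddCommGroup B] [Module k B] : Tens N ρ B →ₗ[k] Tens N ρ' B :=
  LinearMap.rTensor B
    ({ toFun := fun n => res N f n
       map_add' := fun a b => map_add (res N f) a b
       map_smul' := fun r n => by subst h; exact res_smul N f (ρ r) n } :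
      Restr ρ (N.obj (op d)) →ₗ[k] Restr ρ' (N.obj (op d')))

/-- The action of `O(d)` on `N(d) ⊗ₖ B`. -/
abbrev tensModule (N : ModPresheaf O) {d : D} (ρ : k →+* O.obj (op d))
    (B : Type u) [AddCommGroup B] [Module k B] : Module (O.obj (op d)) (Tens N ρ B) :=
  letI : Module (O.obj (op d)) (Restr ρ (N.obj (op d))) :=
    inferInstanceAs (Module (O.obj (op d)) (N.obj (op d)))
  haveI : SMulCommClass k (O.obj (op d)) (Restr ρ (N.obj (op d))) :=
    ⟨fun r s n => smul_comm (M := O.obj (op d)) (N := O.obj (op d)) (α := N.obj (op d)) (ρ r) s n⟩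
  haveI : SMulCommClass (O.obj (op d)) k (Restr ρ (N.obj (op d))) := SMulCommClass.symm _ _ _
  TensorProduct.leftModule

attribute [local instance] tensModule in
theorem lTensor_tensModule_smul (N : ModPresheaf O) {d : D} (ρ : k →+* O.obj (op d))
    {B B' : Type u} [AddCommGroup B] [Module k B] [AddCommGroup B'] [Module k B']
    (g : B →ₗ[k] B') (r : O.obj (op d)) (t : Tens N ρ B) :
    g.lTensor (Restr ρ (N.obj (op d))) (r • t) = r • g.lTensor (Restr ρ (N.obj (op d))) t := by
  induction t using TensorProduct.induction_on with
  | zero => simp only [smul_zero, map_zero]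
  | add x y hx hy => simp only [smul_add, map_add, hx, hy]
  | tmul n b => rfl

theorem tensResOfEq_rfl (N : ModPresheaf O) {d d' : D} (f : d' ⟶ d) (ρ : k →+* O.obj (op d))
    (B : Type u) [AddCommGroup B] [Module k B] :
    tensResOfEq N f ρ _ rfl B = tensRes N f ρ B := rfl

theorem tensResOfEq_id (N : ModPresheaf O) {d : D} (ρ : k →+* O.obj (op d))
    (h : ρ = (O.map (𝟙 d).op).hom.comp ρ) (B : Type u) [AddCommGroup B] [Module k B]
    (t : Tens N ρ B) : tensResOfEq N (𝟙 d) ρ ρ h B t = t := by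
  induction t using TensorProduct.induction_on with
  | zero => exact map_zero _
  | add x y hx hy => rw [map_add, hx, hy]
  | tmul n b => exact congrArg (fun m => TensorProduct.tmul k m b) (res_id N n)

theorem tensResOfEq_comp (N : ModPresheaf O) {d d' d'' : D} (g : d'' ⟶ d') (f : d' ⟶ d)
    (ρ : k →+* O.obj (op d)) (ρ' : k →+* O.obj (op d')) (ρ'' : k →+* O.obj (op d''))
    (h : ρ' = (O.map f.op).hom.comp ρ) (h' : ρ'' = (O.map g.op).hom.comp ρ')
    (h'' : ρ'' = (O.map (g ≫ f).op).hom.comp ρ) (B : Type u) [AddCommGroup B] [Module k B]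
    (t : Tens N ρ B) :
    tensResOfEq N (g ≫ f) ρ ρ'' h'' B t =
      tensResOfEq N g ρ' ρ'' h' B (tensResOfEq N f ρ ρ' h B t) := by
  induction t using TensorProduct.induction_on with
  | zero => simp only [map_zero]
  | add x y hx hy => simp only [map_add, hx, hy]
  | tmul n b => exact congrArg (fun m => TensorProduct.tmul k m b) (res_comp N g f n)

theorem tensResOfEq_lTensor (N : ModPresheaf O) {d d' : D} (f : d' ⟶ d) (ρ : k →+* O.obj (op d))
    (ρ' : k →+* O.obj (op d')) (h : ρ' = (O.map f.op).hom.comp ρ)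
    {B B' : Type u} [AddCommGroup B] [Module k B] [AddCommGroup B'] [Module k B']
    (g : B →ₗ[k] B') (t : Tens N ρ B) :
    tensResOfEq N f ρ ρ' h B' (g.lTensor _ t) = g.lTensor _ (tensResOfEq N f ρ ρ' h B t) := by
  induction t using TensorProduct.induction_on with
  | zero => simp only [map_zero]
  | add x y hx hy => simp only [map_add, hx, hy]
  | tmul n b => rfl

variable (N : ModPresheaf O) (ρ : ∀ d : D, k →+* O.obj (op d))
  (hρ : ∀ {d d' : D} (f : d' ⟶ d), ρ d' = (O.map f.op).hom.comp (ρ d))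

/-- The presheaf of modules `d ↦ N(d) ⊗ₖ B`. -/
def tensPresheaf (B : Type u) [AddCommGroup B] [Module k B] : ModPresheaf O :=
  letI F : Dᵒᵖ ⥤ Ab.{u} :=
    { obj d := AddCommGrpCat.of (Tens N (ρ d.unop) B)
      map f := AddCommGrpCat.ofHom (tensResOfEq N f.unop _ _ (hρ f.unop) B).toAddMonoidHom
      map_id d := by
        ext t
        exact tensResOfEq_id N _ (hρ (𝟙 d.unop)) B t
      map_comp f g := by
        ext t
        exact tensResOfEq_comp N g.unop f.unop _ _ _ (hρ f.unop) (hρ g.unop)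
          (hρ (g.unop ≫ f.unop)) B t }
  letI (d : Dᵒᵖ) : Module ((O ⋙ forget₂ CommRingCat.{u} RingCat.{u}).obj d) (F.obj d) :=
    tensModule N (ρ d.unop) B
  PresheafOfModules.ofPresheaf F fun d d' f r t => by
    induction t using TensorProduct.induction_on with
    | zero =>
      rw [smul_zero, map_zero, smul_zero]
    | add x y hx hy => rw [smul_add, map_add, map_add, smul_add, hx, hy]
    | tmul n b => exact congrArg (fun m => TensorProduct.tmul k m b) (res_smul N f.unop r n)

/-- The map `N ⊗ₖ B → N ⊗ₖ B'` of presheaves of modules induced by a `k`-linear map `B → B'`. -/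
def tensPresheafMap {B B' : Type u} [AddCommGroup B] [Module k B] [AddCommGroup B'] [Module k B']
    (g : B →ₗ[k] B') : tensPresheaf N ρ hρ B ⟶ tensPresheaf N ρ hρ B' :=
  PresheafOfModules.homMk
    { app d := AddCommGrpCat.ofHom (g.lTensor (Restr (ρ d.unop) (N.obj d))).toAddMonoidHom
      naturality d d' f := by
        ext t
        exact (tensResOfEq_lTensor N f.unop _ _ (hρ f.unop) g t).symm }
    fun d r t => lTensor_tensModule_smul N (ρ d.unop) g r t

end TensorFunctoriality

/-! ### The Amitsur complex and its contraction -/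

section Amitsur

open TensorProduct

variable (k A : Type*) [CommRing k] [CommRing A] [Algebra k A]

/-- `a ⊗ b ↦ a ⊗ (b ⊗ 1)` -/
def amitsurFace₁₂ : A ⊗[k] A →ₐ[k] A ⊗[k] (A ⊗[k] A) :=
  Algebra.TensorProduct.map (AlgHom.id k A) Algebra.TensorProduct.includeLeft

/-- `a ⊗ b ↦ a ⊗ (1 ⊗ b)` -/
def amitsurFace₁₃ : A ⊗[k] A →ₐ[k] A ⊗[k] (A ⊗[k] A) :=
  Algebra.TensorProduct.map (AlgHom.id k A) Algebra.TensorProduct.includeRight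

/-- `a ⊗ b ↦ 1 ⊗ (a ⊗ b)` -/
def amitsurFace₂₃ : A ⊗[k] A →ₐ[k] A ⊗[k] (A ⊗[k] A) :=
  Algebra.TensorProduct.includeRight

/-- The first differential `A → A ⊗ A` of the Amitsur complex, `a ↦ a ⊗ 1 - 1 ⊗ a`. -/
def amitsur₀ : A →ₗ[k] A ⊗[k] A :=
  (Algebra.TensorProduct.includeLeft : A →ₐ[k] A ⊗[k] A).toLinearMap -
    (Algebra.TensorProduct.includeRight : A →ₐ[k] A ⊗[k] A).toLinearMap

/-- The second differential `A ⊗ A → A ⊗ A ⊗ A` of the Amitsur complex. -/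
def amitsur₁ : A ⊗[k] A →ₗ[k] A ⊗[k] (A ⊗[k] A) :=
  (amitsurFace₁₂ k A).toLinearMap - (amitsurFace₁₃ k A).toLinearMap +
    (amitsurFace₂₃ k A).toLinearMap

variable {k A}

theorem amitsur₀_apply (a : A) : amitsur₀ k A a = a ⊗ₜ 1 - 1 ⊗ₜ a := rfl

theorem amitsur₁_tmul (a b : A) :
    amitsur₁ k A (a ⊗ₜ b) = a ⊗ₜ (b ⊗ₜ 1) - a ⊗ₜ (1 ⊗ₜ b) + 1 ⊗ₜ (a ⊗ₜ b) := rfl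

theorem amitsur₁_comp_amitsur₀ : amitsur₁ k A ∘ₗ amitsur₀ k A = 0 := by
  ext a
  simp only [LinearMap.comp_apply, amitsur₀_apply, map_sub, amitsur₁_tmul,
    LinearMap.zero_apply]
  abel

variable (k A)

/-- The contraction `a ⊗ b ⊗ c ↦ a ⊗ b c`. -/
def amitsurHomotopy₀ : (A ⊗[k] A) ⊗[k] A →ₗ[k] A ⊗[k] A :=
  (LinearMap.mul' k A).lTensor A ∘ₗ (TensorProduct.assoc k A A A).toLinearMap

/-- The contraction `a ⊗ b ⊗ c ⊗ d ↦ a ⊗ b ⊗ c d`. -/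
def amitsurHomotopy₁ : (A ⊗[k] (A ⊗[k] A)) ⊗[k] A →ₗ[k] (A ⊗[k] A) ⊗[k] A :=
  (LinearMap.mul' k A).lTensor (A ⊗[k] A) ∘ₗ
    (TensorProduct.assoc k (A ⊗[k] A) A A).toLinearMap ∘ₗ
      (TensorProduct.assoc k A A A).symm.toLinearMap.rTensor A

/-- After `- ⊗ A` the spare last factor serves as a section of the cover: multiplying it into its
neighbour splits the complex. On `a ⊗ b ⊗ c` the terms `a ⊗ 1 ⊗ bc` and `1 ⊗ a ⊗ bc` cancel and `a ⊗
b ⊗ c` remains. -/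
theorem amitsur_homotopy :
    (amitsur₀ k A).rTensor A ∘ₗ amitsurHomotopy₀ k A +
      amitsurHomotopy₁ k A ∘ₗ (amitsur₁ k A).rTensor A = LinearMap.id := by
  refine TensorProduct.ext_threefold fun a b c => ?_
  have h₀ : ∀ a b c : A, amitsurHomotopy₀ k A ((a ⊗ₜ b) ⊗ₜ c) = a ⊗ₜ (b * c) :=
    fun _ _ _ => rfl
  have h₁ : ∀ a b c d : A,
      amitsurHomotopy₁ k A ((a ⊗ₜ (b ⊗ₜ c)) ⊗ₜ d) = (a ⊗ₜ b) ⊗ₜ (c * d) := fun _ _ _ _ => rfl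
  simp only [LinearMap.add_apply, LinearMap.comp_apply, h₀, LinearMap.rTensor_tmul,
    amitsur₀_apply, amitsur₁_tmul, TensorProduct.sub_tmul, TensorProduct.add_tmul, map_sub,
    map_add, h₁, one_mul, LinearMap.id_apply]
  abel

end Amitsur

/-! ### Contractions survive tensoring -/

section ContractibleTensor

open TensorProduct

variable {k P B₁ B₂ B₃ B : Type*} [CommRing k] [AddCommGroup P] [Module k P]
  [AddCommGroup B₁] [Module k B₁] [AddCommGroup B₂] [Module k B₂] [AddCommGroup B₃] [Module k B₃]
  [AddCommGroup B] [Module k B]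

theorem assoc_rTensor_lTensor (f : B₁ →ₗ[k] B₂) (x : (P ⊗[k] B₁) ⊗[k] B) :
    TensorProduct.assoc k P B₂ B ((f.lTensor P).rTensor B x) =
      (f.rTensor B).lTensor P (TensorProduct.assoc k P B₁ B x) := by
  rw [← LinearEquiv.coe_coe, ← LinearEquiv.coe_coe, ← LinearMap.comp_apply,
    ← LinearMap.comp_apply]
  congr 1
  exact TensorProduct.ext_threefold fun _ _ _ => rfl

/-- The additive functor `P ⊗ -` preserves the homotopy identity; the associator moves `B` past `P`.
On a cycle the second term of the identity vanishes, so `s` supplies the preimage, with no flatness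
assumption on `P`. -/
theorem exists_of_contraction (f : B₁ →ₗ[k] B₂) (g : B₂ →ₗ[k] B₃)
    (s : B₂ ⊗[k] B →ₗ[k] B₁ ⊗[k] B) (s' : B₃ ⊗[k] B →ₗ[k] B₂ ⊗[k] B)
    (hs : f.rTensor B ∘ₗ s + s' ∘ₗ g.rTensor B = LinearMap.id)
    (y : (P ⊗[k] B₂) ⊗[k] B) (hy : (g.lTensor P).rTensor B y = 0) :
    ∃ x : (P ⊗[k] B₁) ⊗[k] B, (f.lTensor P).rTensor B x = y := by
  refine ⟨(TensorProduct.assoc k P B₁ B).symm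
    (s.lTensor P (TensorProduct.assoc k P B₂ B y)), ?_⟩
  apply (TensorProduct.assoc k P B₂ B).injective
  have hg := assoc_rTensor_lTensor g y
  rw [hy, map_zero] at hg
  have h := LinearMap.congr_fun (congrArg (LinearMap.lTensor P) hs)
    (TensorProduct.assoc k P B₂ B y)
  rw [LinearMap.lTensor_add, LinearMap.lTensor_comp, LinearMap.lTensor_comp, LinearMap.add_apply,
    LinearMap.comp_apply, LinearMap.comp_apply, ← hg, map_zero, add_zero, LinearMap.lTensor_id,
    LinearMap.id_apply] at h
  rw [assoc_rTensor_lTensor, LinearEquiv.apply_symm_apply, h]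

end ContractibleTensor

/-! ### Contractions and local exactness of presheaves -/

section Presheaves

variable {D : Type u} [Category.{u} D] {O : Dᵒᵖ ⥤ CommRingCat.{u}} {k : Type u} [CommRing k]

theorem tensMap_tensRes {N N' : ModPresheaf O} (φ : N ⟶ N') {d d' : D} (f : d' ⟶ d)
    (ρ : k →+* O.obj (op d)) (B : Type u) [AddCommGroup B] [Module k B] (t : Tens N ρ B) :
    tensMap φ _ B (tensRes N f ρ B t) = tensRes N' f ρ B (tensMap φ ρ B t) := by
  induction t using TensorProduct.induction_on with
  | zero => simp only [map_zero]
  | add x y hx hy => simp only [map_add, hx, hy]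
  | tmul n b =>
    exact congrArg (fun m => TensorProduct.tmul k m b)
      (PresheafOfModules.naturality_apply φ f.op n)

variable (N : ModPresheaf O) (ρ : ∀ d : D, k →+* O.obj (op d))
  (hρ : ∀ {d d' : D} (f : d' ⟶ d), ρ d' = (O.map f.op).hom.comp (ρ d))

theorem tensPresheafMap_comp_eq_zero {B₁ B₂ B₃ : Type u} [AddCommGroup B₁] [Module k B₁]
    [AddCommGroup B₂] [Module k B₂] [AddCommGroup B₃] [Module k B₃] (f : B₁ →ₗ[k] B₂)
    (g : B₂ →ₗ[k] B₃) (hgf : g ∘ₗ f = 0) :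
    tensPresheafMap N ρ hρ f ≫ tensPresheafMap N ρ hρ g = 0 := by
  have h (d : D) (t : Tens N (ρ d) B₁) : g.lTensor _ (f.lTensor _ t) = 0 := by
    rw [← LinearMap.comp_apply, ← LinearMap.lTensor_comp, hgf, LinearMap.lTensor_zero,
      LinearMap.zero_apply]
  ext d t
  exact h d.unop t

/-- The two `k`-module structures on `N(d) ⊗ₖ B` agree. -/
def restrTensEquiv (B : Type u) [AddCommGroup B] [Module k B] (d : D) :
    Restr (ρ d) ((tensPresheaf N ρ hρ B).obj (op d)) ≃ₗ[k] Tens N (ρ d) B where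
  toFun t := t
  invFun t := t
  left_inv _ := rfl
  right_inv _ := rfl
  map_add' _ _ := rfl
  map_smul' r t := by
    let := tensModule N (ρ d) B
    change ρ d r • (show Tens N (ρ d) B from t) = r • (show Tens N (ρ d) B from t)
    induction (show Tens N (ρ d) B from t) using TensorProduct.induction_on with
    | zero => simp only [smul_zero]
    | add x y hx hy => simp only [smul_add, hx, hy]
    | tmul n b => rfl

theorem tensMap_tensPresheafMap {B₁ B₂ : Type u} [AddCommGroup B₁] [Module k B₁]
    [AddCommGroup B₂] [Module k B₂] (f : B₁ →ₗ[k] B₂) (B : Type u) [AddCommGroup B] [Module k B]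
    (d : D) (t : Tens (tensPresheaf N ρ hρ B₁) (ρ d) B) :
    (restrTensEquiv N ρ hρ B₂ d).toLinearMap.rTensor B
        (tensMap (tensPresheafMap N ρ hρ f) (ρ d) B t) =
      (f.lTensor (Restr (ρ d) (N.obj (op d)))).rTensor B
        ((restrTensEquiv N ρ hρ B₁ d).toLinearMap.rTensor B t) := by
  induction t using TensorProduct.induction_on with
  | zero => simp only [map_zero]
  | add x y hx hy => simp only [map_add, hx, hy]
  | tmul n b => rfl

theorem locallyExactTens_of_contraction (K : GrothendieckTopology D) {B₁ B₂ B₃ B : Type u}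
    [AddCommGroup B₁] [Module k B₁] [AddCommGroup B₂] [Module k B₂] [AddCommGroup B₃]
    [Module k B₃] [AddCommGroup B] [Module k B] (f : B₁ →ₗ[k] B₂) (g : B₂ →ₗ[k] B₃)
    (s : TensorProduct k B₂ B →ₗ[k] TensorProduct k B₁ B)
    (s' : TensorProduct k B₃ B →ₗ[k] TensorProduct k B₂ B)
    (hs : f.rTensor B ∘ₗ s + s' ∘ₗ g.rTensor B = LinearMap.id) :
    LocallyExactTens K (tensPresheafMap N ρ hρ f) (tensPresheafMap N ρ hρ g) ρ B := by
  intro d y hy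
  -- The contraction gives a preimage over `d` itself, so the maximal sieve suffices and the
  -- preimage is merely restricted.
  refine ⟨⊤, K.top_mem d, fun d' i _ => ?_⟩
  have hy' := tensMap_tensPresheafMap N ρ hρ g B d y
  rw [hy, map_zero] at hy'
  obtain ⟨x, hx⟩ := exists_of_contraction f g s s' hs _ hy'.symm
  refine ⟨tensRes _ i (ρ d) B ((restrTensEquiv N ρ hρ B₁ d).symm.toLinearMap.rTensor B x), ?_⟩
  rw [tensMap_tensRes]
  congr 1
  apply (LinearEquiv.rTensor B (restrTensEquiv N ρ hρ B₂ d)).injective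
  refine (tensMap_tensPresheafMap N ρ hρ f B d _).trans (Eq.trans ?_ hx)
  congr 1
  exact (LinearEquiv.rTensor B (restrTensEquiv N ρ hρ B₁ d)).apply_symm_apply x

end Presheaves

/-! ### Faithfully flat descent for the Amitsur complex -/

section FaithfullyFlat

variable {C : Type u} [SmallCategory C] {J : GrothendieckTopology C}
  {R : Sheaf J CommRingCat.{u}}

/-- Faithfully flat descent: the Amitsur complex of `M` is exact. -/
theorem exists_amitsur₀_eq (M : Modules R) {V : C} {A : Type u} [CommRing A]
    [Algebra (R.obj.obj (op V)) A] (hA : IsFaithfullyFlat R V A) {V' : C} (h : V' ⟶ V)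
    (ρ : R.obj.obj (op V) →+* R.obj.obj (op V')) (hρ : ρ = (R.obj.map h.op).hom)
    (t : Tens M.pre ρ (TensorProduct (R.obj.obj (op V)) A A))
    (ht : (amitsur₁ (R.obj.obj (op V)) A).lTensor (Restr ρ (M.pre.obj (op V'))) t = 0) :
    ∃ S ∈ J V', ∀ (V'' : C) (f : V'' ⟶ V'), S f →
      ∃ u : Tens M.pre ((R.obj.map f.op).hom.comp ρ) A,
        (amitsur₀ (R.obj.obj (op V)) A).lTensor _ u = tensRes M.pre f ρ _ t := by
  -- This is the form that the structure map takes at the terminal object `Over.mk (𝟙 V')` of the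
  -- slice, where `t` will be used as a section.
  obtain rfl : ρ = (R.obj.map (𝟙 V' ≫ h).op).hom := by rw [hρ, Category.id_comp]
  let N : ModPresheaf ((Over.forget V').op ⋙ R.obj) :=
    (PresheafOfModules.pushforward₀ (Over.forget V') _).obj M.pre
  let ρ (W : Over V') : R.obj.obj (op V) →+* ((Over.forget V').op ⋙ R.obj).obj (op W) :=
    (R.obj.map (W.hom ≫ h).op).hom
  have hρ {W W' : Over V'} (f : W' ⟶ W) :
      ρ W' = (((Over.forget V').op ⋙ R.obj).map f.op).hom.comp (ρ W) := by
    change _ = (R.obj.map f.left.op).hom.comp (R.obj.map (W.hom ≫ h).op).hom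
    rw [← CommRingCat.hom_comp, ← R.obj.map_comp, ← op_comp, ← Category.assoc, Over.w]
  -- Faithful flatness reflects exactness, so it is enough that the Amitsur complex of `N` is exact
  -- after tensoring with `A`, where it is contractible.
  have hex := (hA V' h _ _ _ (tensPresheafMap N ρ hρ (amitsur₀ (R.obj.obj (op V)) A))
    (tensPresheafMap N ρ hρ (amitsur₁ (R.obj.obj (op V)) A))
    (tensPresheafMap_comp_eq_zero N ρ hρ _ _ amitsur₁_comp_amitsur₀)).2
    (locallyExactTens_of_contraction N ρ hρ (J.over V') _ _ _ _ (amitsur_homotopy _ A))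
  obtain ⟨S, hS, hS'⟩ := hex (Over.mk (𝟙 V')) t ht
  refine ⟨Sieve.overEquiv _ S, hS, fun V'' f hf => ?_⟩
  rw [Sieve.overEquiv_iff] at hf
  obtain ⟨x, hx⟩ := hS' _ _ hf
  -- The type `Tens M.pre ρ' A` depends on `ρ'`, and the two ring maps agree only propositionally;
  -- generalizing `ρ'` allows substitution.
  have key : ∀ (ρ' : R.obj.obj (op V) →+* R.obj.obj (op V''))
      (h' : ρ' = (R.obj.map f.op).hom.comp (R.obj.map (𝟙 V' ≫ h).op).hom)
      (x : Tens M.pre ρ' A), (amitsur₀ (R.obj.obj (op V)) A).lTensor _ x =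
        tensResOfEq M.pre f _ ρ' h' _ t →
      ∃ u : Tens M.pre ((R.obj.map f.op).hom.comp (R.obj.map (𝟙 V' ≫ h).op).hom) A,
        (amitsur₀ (R.obj.obj (op V)) A).lTensor _ u = tensRes M.pre f _ _ t := by
    rintro _ rfl x hx
    exact ⟨x, hx⟩
  exact key _ (hρ (Over.homMk f : Over.mk (f ≫ 𝟙 V') ⟶ Over.mk (𝟙 V'))) x hx

end FaithfullyFlat

/-! ### Functions into `M` and locally bijective maps -/

section Extension

variable {C : Type u} [SmallCategory C] {J : GrothendieckTopology C}
  {R : Sheaf J CommRingCat.{u}}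

/-- The sheaf of sets underlying a sheaf of modules, at stage `V`. -/
def typeSheaf (M : Modules R) (V : C) : Sheaf (J.over V) (Type u) :=
  (J.overPullback (Type u) V).obj
    ⟨M.pre.presheaf ⋙ forget Ab.{u}, (Presheaf.isSheaf_iff_isSheaf_forget J _ _).1 M.isSheaf⟩

/-- A function `X → M` as a map of presheaves. -/
def Maps.toHom {V : C} {X : (Over V)ᵒᵖ ⥤ Type u} {M : Modules R} (s : Maps X M) :
    X ⟶ (typeSheaf M V).obj where
  app W := ↾fun x => s.1 W.unop x
  naturality W W' f := by
    ext x
    exact s.2 W.unop W'.unop f.unop x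

/-- A map of presheaves as a function `X → M`. -/
def Maps.ofHom {V : C} {X : (Over V)ᵒᵖ ⥤ Type u} {M : Modules R}
    (η : X ⟶ (typeSheaf M V).obj) : Maps X M :=
  ⟨fun W x => η.app (op W) x, fun _ _ f x => NatTrans.naturality_apply η f.op x⟩

/-- Composition of a function `Y → M` with a map `X → Y`. -/
def Maps.precomp {V : C} {X Y : (Over V)ᵒᵖ ⥤ Type u} {M : Modules R} (η : X ⟶ Y)
    (s : Maps Y M) : Maps X M :=
  ⟨fun W x => s.1 W (η.app (op W) x), fun W W' f x =>
    (congrArg (s.1 W') (NatTrans.naturality_apply η f.op x)).trans (s.2 W W' f _)⟩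

/-- Locally bijective maps become isomorphisms after sheafification, and `M` is a sheaf, so maps
into it factor through `η`. -/
theorem Maps.exists_precomp_eq {V : C} {X Y : (Over V)ᵒᵖ ⥤ Type u} {M : Modules R} (η : X ⟶ Y)
    [Presheaf.IsLocallyInjective (J.over V) η] [Presheaf.IsLocallySurjective (J.over V) η]
    (s : Maps X M) : ∃ s' : Maps Y M, Maps.precomp η s' = s := by
  obtain ⟨θ, hθ⟩ := ((J.over V).W_of_isLocallyBijective η _ (typeSheaf M V).property).2
    (Maps.toHom s)
  refine ⟨Maps.ofHom θ, Subtype.ext (funext fun W => funext fun x => ?_)⟩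
  exact ConcreteCategory.congr_hom (NatTrans.congr_app hθ (op W)) x

theorem eq_of_locally_eq (M : Modules R) {V : C} {S : Sieve V} (hS : S ∈ J V)
    {m m' : M.pre.obj (op V)}
    (h : ∀ (V' : C) (f : V' ⟶ V), S f → res M.pre f m = res M.pre f m') : m = m' := by
  have hM := (isSheaf_iff_isSheaf_of_type J _).1
    ((Presheaf.isSheaf_iff_isSheaf_forget J _ (forget Ab.{u})).1 M.isSheaf)
  exact (hM.isSeparated S hS).ext fun V' f hf => h V' f hf

theorem Maps.eq_of_locally_eq {V : C} {X : (Over V)ᵒᵖ ⥤ Type u} {M : Modules R} {s s' : Maps X M}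
    (h : ∃ S ∈ J V, ∀ (V' : C) (f : V' ⟶ V), S f → Maps.restrict f s = Maps.restrict f s') :
    s = s' := by
  obtain ⟨S, hS, h⟩ := h
  refine Subtype.ext (funext fun W => funext fun x => ?_)
  refine InternalSAG.eq_of_locally_eq M (J.pullback_stable W.hom hS) fun V' f hf => ?_
  let i : (Over.map (f ≫ W.hom)).obj (Over.mk (𝟙 V')) ⟶ W := Over.homMk f (by simp)
  have := congrFun (congrFun (congrArg Subtype.val (h V' (f ≫ W.hom) hf)) (Over.mk (𝟙 V')))
    (X.map i.op x)
  exact (s.2 W _ i x).symm.trans (this.trans (s'.2 W _ i x))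

/-- On the intersection of the image sieves of the two coordinates, a pair in `Y × Y` lifts to `X ×
X`; values in the sheaf `M` may be compared there. -/
theorem Maps.eq_of_precomp_eq {V : C} {X Y : (Over V)ᵒᵖ ⥤ Type u} {M : Modules R} (η : X ⟶ Y)
    [Presheaf.IsLocallySurjective (J.over V) η] {s s' : Maps (prodType Y Y) M}
    (h : ∀ (W : Over V) (x x' : X.obj (op W)),
      s.1 W (η.app (op W) x, η.app (op W) x') = s'.1 W (η.app (op W) x, η.app (op W) x')) :
    s = s' := by
  refine Subtype.ext (funext fun W => funext fun y => ?_)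
  refine InternalSAG.eq_of_locally_eq M (J.intersection_covering
    (Presheaf.imageSieve_mem (J.over V) η y.1)
    (Presheaf.imageSieve_mem (J.over V) η y.2)) fun V' f hf => ?_
  obtain ⟨x, hx⟩ := (Sieve.overEquiv_iff _ _).1 hf.1
  obtain ⟨x', hx'⟩ := (Sieve.overEquiv_iff _ _).1 hf.2
  have key := h _ x x'
  rw [hx, hx'] at key
  let i : Over.mk (f ≫ W.hom) ⟶ W := Over.homMk f
  exact (s.2 W _ i y).symm.trans (key.trans (s'.2 W _ i y))

/-- The comparison of iterated restrictions. -/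
def restrCompHom {V V' V'' : C} (f : V' ⟶ V) (g : V'' ⟶ V') (X : (Over V)ᵒᵖ ⥤ Type u) :
    restr (g ≫ f) X ⟶ restr g (restr f X) :=
  Functor.whiskerRight (NatTrans.op (Over.mapComp g f).inv) X

theorem Maps.exists_d₀_eq_of_comp {V V' V'' : C} {X : (Over V)ᵒᵖ ⥤ Type u} {M : Modules R}
    (f : V' ⟶ V) (g : V'' ⟶ V') (c : Maps (prodType X X) M)
    (h : ∃ b : Maps (restr g (restr f X)) M,
      d₀ (restr g (restr f X)) M b = Maps.restrict g (Maps.restrict f c)) :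
    ∃ b : Maps (restr (g ≫ f) X) M, d₀ (restr (g ≫ f) X) M b = Maps.restrict (g ≫ f) c := by
  obtain ⟨b, hb⟩ := h
  refine ⟨Maps.precomp (restrCompHom f g X) b, Subtype.ext (funext fun W => funext fun x => ?_)⟩
  have hb' := congrFun (congrFun (congrArg Subtype.val hb) W)
    ((restrCompHom f g X).app _ x.1, (restrCompHom f g X).app _ x.2)
  have hc := c.2 _ _ ((Over.mapComp g f).inv.app W) x
  -- The two iterated restrictions differ by an isomorphism lying over an identity of `C`, so
  -- naturality of `c` along it changes no values.
  have hi : ((Over.mapComp g f).inv.app W).left = 𝟙 W.left := by simp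
  rw [hi] at hc
  exact hb'.trans (hc.trans (res_id M.pre _))

end Extension

/-! ### Tensor powers of a finite product of algebras -/

section Products

open TensorProduct

variable {k : Type*} [CommRing k] {I : Type*} (A : I → Type*)
  [∀ i, CommRing (A i)] [∀ i, Algebra k (A i)]

/-- The projection `(∏ A) ⊗ (∏ A) → A i ⊗ A j`. -/
def projTens₂ (i j : I) : (∀ i, A i) ⊗[k] (∀ i, A i) →ₐ[k] A i ⊗[k] A j :=
  Algebra.TensorProduct.map (Pi.evalAlgHom k A i) (Pi.evalAlgHom k A j)

/-- The projection `(∏ A) ⊗ (∏ A) ⊗ (∏ A) → A i ⊗ A j ⊗ A l`. -/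
def projTens₃ (i j l : I) : (∀ i, A i) ⊗[k] ((∀ i, A i) ⊗[k] (∀ i, A i)) →ₐ[k]
    A i ⊗[k] (A j ⊗[k] A l) :=
  Algebra.TensorProduct.map (Pi.evalAlgHom k A i) (projTens₂ A j l)

variable {A} [Finite I] {P : Type*} [AddCommGroup P] [Module k P]

/-- A finite product is a direct sum of modules, and tensor products distribute over it: summing the
insertions of the `t i j` works, as all mismatched components vanish. -/
theorem exists_projTens₂_eq (t : ∀ i j, P ⊗[k] (A i ⊗[k] A j)) :
    ∃ s : P ⊗[k] ((∀ i, A i) ⊗[k] (∀ i, A i)), ∀ i j,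
      (projTens₂ A i j).toLinearMap.lTensor P s = t i j := by
  classical
  cases nonempty_fintype I
  let e (i j : I) : A i ⊗[k] A j →ₗ[k] (∀ i, A i) ⊗[k] (∀ i, A i) :=
    TensorProduct.map (LinearMap.single k A i) (LinearMap.single k A j)
  have he (i j i' j' : I) : (projTens₂ A i j).toLinearMap ∘ₗ e i' j' =
      TensorProduct.map (LinearMap.proj i ∘ₗ LinearMap.single k A i')
        (LinearMap.proj j ∘ₗ LinearMap.single k A j') := by
    ext
    rfl
  refine ⟨∑ i, ∑ j, (e i j).lTensor P (t i j), fun i j => ?_⟩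
  simp only [map_sum, ← LinearMap.comp_apply, ← LinearMap.lTensor_comp, he]
  rw [Finset.sum_eq_single i, Finset.sum_eq_single j]
  · simp only [LinearMap.proj_comp_single_same, TensorProduct.map_id, LinearMap.lTensor_id,
      LinearMap.id_apply]
  · intro j' _ hj
    rw [LinearMap.proj_comp_single_ne k A _ _ hj.symm, TensorProduct.map_zero_right,
      LinearMap.lTensor_zero, LinearMap.zero_apply]
  · simp
  · intro i' _ hi
    refine Finset.sum_eq_zero fun j' _ => ?_
    rw [LinearMap.proj_comp_single_ne k A _ _ hi.symm, TensorProduct.map_zero_left,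
      LinearMap.lTensor_zero, LinearMap.zero_apply]
  · simp

theorem eq_zero_of_projTens₃ (t : P ⊗[k] ((∀ i, A i) ⊗[k] ((∀ i, A i) ⊗[k] (∀ i, A i))))
    (ht : ∀ i j l, (projTens₃ (k := k) A i j l).toLinearMap.lTensor P t = 0) : t = 0 := by
  classical
  cases nonempty_fintype I
  let e (i j l : I) : A i ⊗[k] (A j ⊗[k] A l) →ₗ[k]
      (∀ i, A i) ⊗[k] ((∀ i, A i) ⊗[k] (∀ i, A i)) :=
    TensorProduct.map (LinearMap.single k A i)
      (TensorProduct.map (LinearMap.single k A j) (LinearMap.single k A l))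
  -- The identity decomposes into projections followed by insertions, so an element with zero
  -- projections is zero.
  have he : ∑ i, ∑ j, ∑ l, e i j l ∘ₗ (projTens₃ (k := k) A i j l).toLinearMap = LinearMap.id := by
    refine TensorProduct.ext (LinearMap.ext fun a => TensorProduct.ext' fun b c => ?_)
    have h : ∀ i j l, (e i j l ∘ₗ (projTens₃ (k := k) A i j l).toLinearMap) (a ⊗ₜ (b ⊗ₜ c)) =
        Pi.single i (a i) ⊗ₜ (Pi.single j (b j) ⊗ₜ Pi.single l (c l)) := fun _ _ _ => rfl
    change (∑ i, ∑ j, ∑ l, e i j l ∘ₗ (projTens₃ (k := k) A i j l).toLinearMap)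
      (a ⊗ₜ (b ⊗ₜ c)) = a ⊗ₜ (b ⊗ₜ c)
    simp only [LinearMap.sum_apply, h,
      ← TensorProduct.tmul_sum, ← TensorProduct.sum_tmul, Finset.univ_sum_single]
  have h := LinearMap.congr_fun (congrArg (LinearMap.lTensorHom P) he) t
  rw [LinearMap.coe_lTensorHom, LinearMap.lTensor_id, LinearMap.id_apply] at h
  rw [← h]
  simp only [← LinearMap.coe_lTensorHom, map_sum, LinearMap.sum_apply]
  simp only [LinearMap.coe_lTensorHom, LinearMap.lTensor_comp,
    LinearMap.comp_apply, ht, map_zero, Finset.sum_const_zero]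

end Products

/-! ### Points of a product of spectra -/

section Points

open TensorProduct

variable {k A B S : Type*} [CommRing k] [CommRing A] [Algebra k A] [CommRing B] [Algebra k B]
  [CommRing S]

theorem exists_tensor_ringHom (σ : k →+* S) (φ : A →+* S) (ψ : B →+* S)
    (hφ : φ.comp (algebraMap k A) = σ) (hψ : ψ.comp (algebraMap k B) = σ) :
    ∃ χ : A ⊗[k] B →+* S, χ.comp (algebraMap k (A ⊗[k] B)) = σ ∧
      χ.comp (Algebra.TensorProduct.includeLeft : A →ₐ[k] A ⊗[k] B).toRingHom = φ ∧
      χ.comp (Algebra.TensorProduct.includeRight : B →ₐ[k] A ⊗[k] B).toRingHom = ψ := by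
  let := σ.toAlgebra
  let φ' : A →ₐ[k] S := ⟨φ, RingHom.congr_fun hφ⟩
  let ψ' : B →ₐ[k] S := ⟨ψ, RingHom.congr_fun hψ⟩
  let χ : A ⊗[k] B →ₐ[k] S := Algebra.TensorProduct.lift φ' ψ' fun _ _ => Commute.all _ _
  refine ⟨χ.toRingHom, χ.comp_algebraMap, ?_, ?_⟩
  · ext a
    exact (Algebra.TensorProduct.lift_tmul φ' ψ' (fun _ _ => Commute.all _ _) a 1).trans
      (by rw [map_one, mul_one]; rfl)
  · ext b
    exact (Algebra.TensorProduct.lift_tmul φ' ψ' (fun _ _ => Commute.all _ _) 1 b).trans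
      (by rw [map_one, one_mul]; rfl)

end Points

/-! ### Evaluation of tensors at points, and quasicoherence -/

section Evaluation

variable {C : Type u} [SmallCategory C] {J : GrothendieckTopology C}
  {R : Sheaf J CommRingCat.{u}} (M : Modules R)

theorem tensEval_lTensor {V W : C} {k : Type u} [CommRing k] (ρ : k →+* R.obj.obj (op V))
    {A B : Type u} [CommRing A] [Algebra k A] [CommRing B] [Algebra k B] (g : A →ₐ[k] B)
    (f : W ⟶ V) (φ : B →+* R.obj.obj (op W))
    (hφ : φ.comp (algebraMap k B) = (R.obj.map f.op).hom.comp ρ)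
    (hφ' : (φ.comp g.toRingHom).comp (algebraMap k A) = (R.obj.map f.op).hom.comp ρ)
    (t : Tens M.pre ρ A) :
    tensEval M ρ B f φ hφ (g.toLinearMap.lTensor _ t) =
      tensEval M ρ A f (φ.comp g.toRingHom) hφ' t := by
  induction t using TensorProduct.induction_on with
  | zero => simp only [map_zero]
  | add x y hx hy => simp only [map_add, hx, hy]
  | tmul m a => rfl

theorem tensEval_tensRes {V V' W : C} {k : Type u} [CommRing k] (ρ : k →+* R.obj.obj (op V))
    {A : Type u} [CommRing A] [Algebra k A] (f : V' ⟶ V) (g : W ⟶ V')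
    (φ : A →+* R.obj.obj (op W))
    (hφ : φ.comp (algebraMap k A) = (R.obj.map g.op).hom.comp ((R.obj.map f.op).hom.comp ρ))
    (hφ' : φ.comp (algebraMap k A) = (R.obj.map (g ≫ f).op).hom.comp ρ) (t : Tens M.pre ρ A) :
    tensEval M ((R.obj.map f.op).hom.comp ρ) A g φ hφ (tensRes M.pre f ρ A t) =
      tensEval M ρ A (g ≫ f) φ hφ' t := by
  induction t using TensorProduct.induction_on with
  | zero => simp only [map_zero]
  | add x y hx hy => simp only [map_add, hx, hy]
  | tmul m a => exact congrArg (φ a • ·) (res_comp M.pre g f m).symm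

variable {M}

/-- The injective half of quasicoherence, with `ρ` fixed only up to a proposition so that composites
of restriction maps may be used for it. -/
theorem IsQuasicoherent.locally_eq_zero (hM : IsQuasicoherent M) {V : C} {A : Type u}
    [CommRing A] [Algebra (R.obj.obj (op V)) A]
    (hA : Algebra.FinitePresentation (R.obj.obj (op V)) A) {V' : C} (h : V' ⟶ V)
    (ρ : R.obj.obj (op V) →+* R.obj.obj (op V')) (hρ : ρ = (R.obj.map h.op).hom)
    (t : Tens M.pre ρ A)
    (ht : ∀ (W : C) (g : W ⟶ V') (φ : A →+* R.obj.obj (op W))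
      (hφ : φ.comp (algebraMap (R.obj.obj (op V)) A) = (R.obj.map g.op).hom.comp ρ),
      tensEval M ρ A g φ hφ t = 0) :
    ∃ S ∈ J V', ∀ (V'' : C) (f : V'' ⟶ V'), S f → tensRes M.pre f ρ A t = 0 := by
  subst hρ
  exact (hM V A hA V' h).1 t fun W φ => ht W.left W.hom φ.1 _

/-- The surjective half of quasicoherence at the stage `V` itself, freed of the composites with `𝟙
V` in the definition. -/
theorem IsQuasicoherent.exists_tens (hM : IsQuasicoherent M) {V : C} {A : Type u}
    [CommRing A] [Algebra (R.obj.obj (op V)) A]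
    (hA : Algebra.FinitePresentation (R.obj.obj (op V)) A) (s : Maps (Spec R V A) M) :
    ∃ S ∈ J V, ∀ (V' : C) (f : V' ⟶ V), S f → ∃ t : Tens M.pre (R.obj.map f.op).hom A,
      ∀ (W : C) (g : W ⟶ V') (φ : A →+* R.obj.obj (op W))
        (hφ : φ.comp (algebraMap (R.obj.obj (op V)) A) =
          (R.obj.map g.op).hom.comp (R.obj.map f.op).hom)
        (hφ' : φ.comp (algebraMap (R.obj.obj (op V)) A) = (R.obj.map (g ≫ f).op).hom),
        tensEval M (R.obj.map f.op).hom A g φ hφ t = s.1 (Over.mk (g ≫ f)) ⟨φ, hφ'⟩ := by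
  obtain ⟨S, hS, h⟩ := (hM V A hA V (𝟙 V)).2 (Maps.restrict (𝟙 V) s)
  refine ⟨S, hS, fun V' f hf => ?_⟩
  have key : ∀ (ρ : R.obj.obj (op V) →+* R.obj.obj (op V')) (hρ : ρ = (R.obj.map f.op).hom)
      (t : Tens M.pre ρ A), ∃ t' : Tens M.pre (R.obj.map f.op).hom A,
        ∀ (W : C) (g : W ⟶ V') (φ : A →+* R.obj.obj (op W))
          (hφ : φ.comp (algebraMap (R.obj.obj (op V)) A) =
            (R.obj.map g.op).hom.comp (R.obj.map f.op).hom),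
          tensEval M (R.obj.map f.op).hom A g φ hφ t' =
            tensEval M ρ A g φ (by rw [hφ, hρ]) t := by
    rintro _ rfl t
    exact ⟨t, fun _ _ _ _ => rfl⟩
  have hs : ∀ (W : C) (p p' : W ⟶ V) (_ : p = p') (φ : A →+* R.obj.obj (op W))
      (hφ : φ.comp (algebraMap (R.obj.obj (op V)) A) = (R.obj.map p.op).hom)
      (hφ' : φ.comp (algebraMap (R.obj.obj (op V)) A) = (R.obj.map p'.op).hom),
      s.1 (Over.mk p) ⟨φ, hφ⟩ = s.1 (Over.mk p') ⟨φ, hφ'⟩ := by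
    rintro W p _ rfl φ hφ hφ'
    rfl
  obtain ⟨t, ht⟩ := h V' f hf
  obtain ⟨t', ht'⟩ := key _ (by rw [← CommRingCat.hom_comp, ← R.obj.map_comp]; simp) t
  refine ⟨t', fun W g φ hφ hφ' => ?_⟩
  have hφ'' : φ.comp (algebraMap (R.obj.obj (op V)) A) =
      (R.obj.map ((g ≫ f) ≫ 𝟙 V).op).hom := by rw [hφ', Category.comp_id]
  exact (ht' W g φ hφ).trans ((ht (Over.mk g) ⟨φ, hφ''⟩).trans
    (hs W _ _ (Category.comp_id _) φ _ _))

end Evaluation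

/-! ### Cocycles on a finite sum of spectra -/

section Cocycles

variable {C : Type u} [SmallCategory C] {J : GrothendieckTopology C}
  {R : Sheaf J CommRingCat.{u}} {M : Modules R} {V : C} {n : ℕ} {A : Fin n → Type u}
  [∀ i, CommRing (A i)] [∀ i, Algebra (R.obj.obj (op V)) (A i)]

theorem finitePresentation_tensorProduct {k A B : Type*} [CommRing k] [CommRing A] [Algebra k A]
    [CommRing B] [Algebra k B] (hA : Algebra.FinitePresentation k A)
    (hB : Algebra.FinitePresentation k B) :
    Algebra.FinitePresentation k (TensorProduct k A B) :=
  Algebra.FinitePresentation.trans k A (TensorProduct k A B)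

variable (R) in
/-- The map `Spec B → Spec A` given by a map of algebras `A → B`. -/
def specMap {A B : Type u} [CommRing A] [Algebra (R.obj.obj (op V)) A] [CommRing B]
    [Algebra (R.obj.obj (op V)) B] (g : A →ₐ[R.obj.obj (op V)] B) : Spec R V B ⟶ Spec R V A where
  app W := ↾fun φ => ⟨φ.1.comp g.toRingHom, by
    rw [RingHom.comp_assoc, AlgHom.toRingHom_eq_coe, AlgHom.comp_algebraMap, φ.2]⟩
  naturality W W' f := by
    ext φ
    rfl

variable (R A) in
/-- The map `Spec (Aᵢ ⊗ Aⱼ) → (∑ Spec A) × (∑ Spec A)`. -/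
def specPair (i j : Fin n) : Spec R V (TensorProduct (R.obj.obj (op V)) (A i) (A j)) ⟶
    prodType (sumPresheaf fun i => Spec R V (A i)) (sumPresheaf fun i => Spec R V (A i)) where
  app W := ↾fun χ => (⟨i, (specMap R Algebra.TensorProduct.includeLeft).app W χ⟩,
    ⟨j, (specMap R Algebra.TensorProduct.includeRight).app W χ⟩)
  naturality _ _ _ := ConcreteCategory.hom_ext _ _ fun _ => rfl

/-- The tensor `t ∈ M ⊗ (∏ A) ⊗ (∏ A)` at stage `V'` represents the function `c` on
`(∑ Spec A) × (∑ Spec A)`. -/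
def Represents (c : Maps (prodType (sumPresheaf fun i => Spec R V (A i))
      (sumPresheaf fun i => Spec R V (A i))) M) {V' : C} (f : V' ⟶ V)
    (ρ : R.obj.obj (op V) →+* R.obj.obj (op V'))
    (t : Tens M.pre ρ (TensorProduct (R.obj.obj (op V)) (∀ i, A i) (∀ i, A i))) : Prop :=
  ∀ (i j : Fin n) (W : C) (g : W ⟶ V') (e : W ⟶ V), e = g ≫ f →
    ∀ (χ : TensorProduct (R.obj.obj (op V)) (A i) (A j) →+* R.obj.obj (op W))
      (hχ : χ.comp (algebraMap _ _) = (R.obj.map g.op).hom.comp ρ)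
      (hχ' : χ.comp (algebraMap _ _) = (R.obj.map e.op).hom),
      tensEval M ρ _ g χ hχ ((projTens₂ A i j).toLinearMap.lTensor _ t) =
        c.1 (Over.mk e) ((specPair R A i j).app (op (Over.mk e)) ⟨χ, hχ'⟩)

/-- On each of the finitely many pieces `Spec (Aᵢ ⊗ Aⱼ)` quasicoherence gives a tensor locally; on a
common cover these assemble to one tensor over `A ⊗ A`. -/
theorem exists_represents (hM : IsQuasicoherent M)
    (hA : ∀ i, Algebra.FinitePresentation (R.obj.obj (op V)) (A i))
    (c : Maps (prodType (sumPresheaf fun i => Spec R V (A i))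
      (sumPresheaf fun i => Spec R V (A i))) M) :
    ∃ S ∈ J V, ∀ (V' : C) (f : V' ⟶ V), S f →
      ∃ t, Represents c f (R.obj.map f.op).hom t := by
  obtain ⟨S, hS, h⟩ := exists_cover_forall fun i => exists_cover_forall fun j =>
    hM.exists_tens (finitePresentation_tensorProduct (hA i) (hA j))
      (Maps.precomp (specPair R A i j) c)
  refine ⟨S, hS, fun V' f hf => ?_⟩
  choose t ht using h V' f hf
  obtain ⟨s, hs⟩ := exists_projTens₂_eq t
  refine ⟨s, ?_⟩
  rintro i j W g _ rfl χ hχ hχ'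
  rw [hs]
  exact ht i j W g χ hχ hχ'

theorem Represents.tensRes {c : Maps (prodType (sumPresheaf fun i => Spec R V (A i))
      (sumPresheaf fun i => Spec R V (A i))) M} {V' : C} {f : V' ⟶ V}
    {ρ : R.obj.obj (op V) →+* R.obj.obj (op V')}
    {t : Tens M.pre ρ (TensorProduct (R.obj.obj (op V)) (∀ i, A i) (∀ i, A i))}
    (ht : Represents c f ρ t) {V'' : C} (g : V'' ⟶ V') :
    Represents c (g ≫ f) ((R.obj.map g.op).hom.comp ρ) (tensRes M.pre g ρ _ t) := by
  intro i j W p e he χ hχ hχ'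
  have hχ'' : χ.comp (algebraMap _ _) = (R.obj.map (p ≫ g).op).hom.comp ρ := by
    rw [hχ, ← RingHom.comp_assoc, ← CommRingCat.hom_comp, ← R.obj.map_comp, ← op_comp]
  rw [← ht i j W (p ≫ g) e (by rw [he, Category.assoc]) χ hχ'' hχ',
    ← tensEval_tensRes M ρ g p χ hχ]
  exact congrArg (tensEval M _ _ p χ hχ) (tensResOfEq_lTensor M.pre g ρ _ rfl _ t).symm

/-- Evaluated at a point of `Spec (Aᵢ ⊗ Aⱼ ⊗ Aₗ)`, the Amitsur differential of `t` is the cocycle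
expression of `c`. The injective half of quasicoherence makes each component vanish locally. -/
theorem locally_amitsur₁_eq_zero (hM : IsQuasicoherent M)
    (hA : ∀ i, Algebra.FinitePresentation (R.obj.obj (op V)) (A i))
    {c : Maps (prodType (sumPresheaf fun i => Spec R V (A i))
      (sumPresheaf fun i => Spec R V (A i))) M} (hc : d₁ _ M c = 0) {V' : C} {f : V' ⟶ V}
    {ρ : R.obj.obj (op V) →+* R.obj.obj (op V')} (hρ : ρ = (R.obj.map f.op).hom)
    {t : Tens M.pre ρ (TensorProduct (R.obj.obj (op V)) (∀ i, A i) (∀ i, A i))}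
    (ht : Represents c f ρ t) :
    ∃ S ∈ J V', ∀ (V'' : C) (g : V'' ⟶ V'), S g →
      (amitsur₁ (R.obj.obj (op V)) (∀ i, A i)).lTensor _ (tensRes M.pre g ρ _ t) = 0 := by
  have h : ∃ S ∈ J V', ∀ (V'' : C) (g : V'' ⟶ V'), S g → ∀ i j l,
      InternalSAG.tensRes M.pre g ρ _
        ((projTens₃ (k := R.obj.obj (op V)) A i j l).toLinearMap.lTensor _ ((amitsur₁ (R.obj.obj (op V)) (∀ i, A i)).lTensor _ t)) = 0 := by
    refine exists_cover_forall fun i => exists_cover_forall fun j => exists_cover_forall fun l =>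
      hM.locally_eq_zero (finitePresentation_tensorProduct (hA i)
        (finitePresentation_tensorProduct (hA j) (hA l))) f ρ hρ _ fun W g χ hχ => ?_
    have hχ' : χ.comp (algebraMap _ _) = (R.obj.map (g ≫ f).op).hom := by
      rw [hχ, hρ, ← CommRingCat.hom_comp, ← R.obj.map_comp, ← op_comp]
    let q₁₂ : TensorProduct (R.obj.obj (op V)) (A i) (A j) →ₐ[R.obj.obj (op V)]
        TensorProduct (R.obj.obj (op V)) (A i) (TensorProduct (R.obj.obj (op V)) (A j) (A l)) :=
      Algebra.TensorProduct.map (AlgHom.id _ _) Algebra.TensorProduct.includeLeft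
    let q₁₃ : TensorProduct (R.obj.obj (op V)) (A i) (A l) →ₐ[R.obj.obj (op V)]
        TensorProduct (R.obj.obj (op V)) (A i) (TensorProduct (R.obj.obj (op V)) (A j) (A l)) :=
      Algebra.TensorProduct.map (AlgHom.id _ _) Algebra.TensorProduct.includeRight
    let q₂₃ : TensorProduct (R.obj.obj (op V)) (A j) (A l) →ₐ[R.obj.obj (op V)]
        TensorProduct (R.obj.obj (op V)) (A i) (TensorProduct (R.obj.obj (op V)) (A j) (A l)) :=
      Algebra.TensorProduct.includeRight
    -- Each face map is compatible with the projections, so the `(i, j, l)` component involves only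
    -- the components `(i, j)`, `(i, l)` and `(j, l)` of `t`.
    have hq : (projTens₃ (k := R.obj.obj (op V)) A i j l).toLinearMap ∘ₗ
        amitsur₁ (R.obj.obj (op V)) (∀ i, A i) =
        q₁₂.toLinearMap ∘ₗ (projTens₂ A i j).toLinearMap -
          q₁₃.toLinearMap ∘ₗ (projTens₂ A i l).toLinearMap +
          q₂₃.toLinearMap ∘ₗ (projTens₂ A j l).toLinearMap := by
      refine TensorProduct.ext' fun a b => ?_
      rw [LinearMap.comp_apply, amitsur₁_tmul, map_add, map_sub]
      rfl
    rw [← LinearMap.lTensor_comp_apply, hq, LinearMap.lTensor_add, LinearMap.lTensor_sub,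
      LinearMap.add_apply, LinearMap.sub_apply, LinearMap.lTensor_comp_apply,
      LinearMap.lTensor_comp_apply, LinearMap.lTensor_comp_apply, map_add, map_sub]
    have key {B : Type u} [CommRing B] [Algebra (R.obj.obj (op V)) B]
        (q : B →ₐ[R.obj.obj (op V)] TensorProduct (R.obj.obj (op V)) (A i)
          (TensorProduct (R.obj.obj (op V)) (A j) (A l))) :
        (χ.comp q.toRingHom).comp (algebraMap (R.obj.obj (op V)) B) =
          χ.comp (algebraMap (R.obj.obj (op V)) _) := by
      rw [RingHom.comp_assoc, AlgHom.toRingHom_eq_coe, AlgHom.comp_algebraMap]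
    rw [tensEval_lTensor M ρ q₁₂ g χ hχ ((key q₁₂).trans hχ),
      tensEval_lTensor M ρ q₁₃ g χ hχ ((key q₁₃).trans hχ),
      tensEval_lTensor M ρ q₂₃ g χ hχ ((key q₂₃).trans hχ),
      ht i j W g _ rfl _ _ ((key q₁₂).trans hχ'), ht i l W g _ rfl _ _ ((key q₁₃).trans hχ'),
      ht j l W g _ rfl _ _ ((key q₂₃).trans hχ')]
    -- The points `x`, `y`, `z` of `Spec Aᵢ`, `Spec Aⱼ`, `Spec Aₗ` are the coordinates of `χ`; the
    -- goal is the cocycle condition at this triple.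
    let x := (specMap R (V := V) (Algebra.TensorProduct.includeLeft : A i →ₐ[R.obj.obj (op V)]
      TensorProduct (R.obj.obj (op V)) (A i)
        (TensorProduct (R.obj.obj (op V)) (A j) (A l)))).app (op (Over.mk (g ≫ f))) ⟨χ, hχ'⟩
    let y := (specMap R (V := V) Algebra.TensorProduct.includeLeft).app (op (Over.mk (g ≫ f)))
      ((specMap R q₂₃).app (op (Over.mk (g ≫ f))) ⟨χ, hχ'⟩)
    let z := (specMap R (V := V) Algebra.TensorProduct.includeRight).app (op (Over.mk (g ≫ f)))
      ((specMap R q₂₃).app (op (Over.mk (g ≫ f))) ⟨χ, hχ'⟩)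
    exact congrFun (congrFun (congrArg Subtype.val hc) (Over.mk (g ≫ f)))
      (⟨i, x⟩, ⟨j, y⟩, ⟨l, z⟩)
  obtain ⟨S, hS, h⟩ := h
  refine ⟨S, hS, fun V'' g hg => eq_zero_of_projTens₃ _ fun i j l => ?_⟩
  refine Eq.trans ?_ (h V'' g hg i j l)
  simp only [← tensResOfEq_rfl, tensResOfEq_lTensor]

theorem Represents.exists_d₀_eq {c : Maps (prodType (sumPresheaf fun i => Spec R V (A i))
      (sumPresheaf fun i => Spec R V (A i))) M} {V' : C} {f : V' ⟶ V}
    {ρ : R.obj.obj (op V) →+* R.obj.obj (op V')} (hρ : ρ = (R.obj.map f.op).hom)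
    {t : Tens M.pre ρ (TensorProduct (R.obj.obj (op V)) (∀ i, A i) (∀ i, A i))}
    (ht : Represents c f ρ t) (u : Tens M.pre ρ (∀ i, A i))
    (hu : (amitsur₀ (R.obj.obj (op V)) (∀ i, A i)).lTensor _ u = t) :
    ∃ b : Maps (restr f (sumPresheaf fun i => Spec R V (A i))) M,
      d₀ (restr f (sumPresheaf fun i => Spec R V (A i))) M b = Maps.restrict f c := by
  have hφ {W : C} (g : W ⟶ V') (i : Fin n) (φ : A i →+* R.obj.obj (op W))
      (h : φ.comp (algebraMap (R.obj.obj (op V)) (A i)) = (R.obj.map (g ≫ f).op).hom) :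
      (φ.comp (Pi.evalAlgHom (R.obj.obj (op V)) A i).toRingHom).comp (algebraMap _ _) =
        (R.obj.map g.op).hom.comp ρ := by
    rw [RingHom.comp_assoc, AlgHom.toRingHom_eq_coe, AlgHom.comp_algebraMap, h, hρ,
      ← CommRingCat.hom_comp, ← R.obj.map_comp, ← op_comp]
  -- A point of the summand `Spec Aᵢ` becomes a point of `Spec A` by composition with the projection
  -- `A → Aᵢ`, and `u` is evaluated there.
  let b : Maps (restr f (sumPresheaf fun i => Spec R V (A i))) M :=
    ⟨fun W x => tensEval M ρ _ W.hom _ (hφ W.hom x.1 x.2.1 x.2.2) u, by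
      rintro W W' p ⟨i, φ, h⟩
      have h' : ((R.obj.map p.left.op).hom.comp
          (φ.comp (Pi.evalAlgHom (R.obj.obj (op V)) A i).toRingHom)).comp (algebraMap _ _) =
            (R.obj.map (p.left ≫ W.hom).op).hom.comp ρ := by
        rw [RingHom.comp_assoc, hφ W.hom i φ h, ← RingHom.comp_assoc, ← CommRingCat.hom_comp,
          ← R.obj.map_comp, ← op_comp]
      have key := res_tensEval M ρ _ W.hom _ (hφ W.hom i φ h) p.left h' u
      refine Eq.trans ?_ key.symm
      have hw : ∀ (q : W'.left ⟶ V') (_ : q = W'.hom) (ψ : (∀ i, A i) →+* R.obj.obj (op W'.left))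
          (h₁ : ψ.comp (algebraMap _ _) = (R.obj.map W'.hom.op).hom.comp ρ)
          (h₂ : ψ.comp (algebraMap _ _) = (R.obj.map q.op).hom.comp ρ),
          tensEval M ρ _ W'.hom ψ h₁ u = tensEval M ρ _ q ψ h₂ u := by
        rintro _ rfl ψ h₁ h₂
        rfl
      exact hw _ (Over.w p) _ _ _⟩
  refine ⟨b, Subtype.ext (funext fun W => funext ?_)⟩
  rintro ⟨⟨i, φ, h⟩, ⟨j, ψ, h'⟩⟩
  -- Every pair of points comes from a point of `Spec (Aᵢ ⊗ Aⱼ)`, where the value of `c` is read off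
  -- from `t`.
  obtain ⟨χ, hχ, rfl, rfl⟩ := exists_tensor_ringHom _ φ ψ h h'
  have hχ' : χ.comp (algebraMap _ _) = (R.obj.map W.hom.op).hom.comp ρ := by
    rw [hχ, hρ, ← CommRingCat.hom_comp, ← R.obj.map_comp, ← op_comp]
    rfl
  refine Eq.trans ?_ (ht i j W.left W.hom _ rfl χ hχ' hχ)
  let ql : (∀ i, A i) →ₐ[R.obj.obj (op V)] TensorProduct (R.obj.obj (op V)) (A i) (A j) :=
    Algebra.TensorProduct.includeLeft.comp (Pi.evalAlgHom (R.obj.obj (op V)) A i)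
  let qr : (∀ i, A i) →ₐ[R.obj.obj (op V)] TensorProduct (R.obj.obj (op V)) (A i) (A j) :=
    Algebra.TensorProduct.includeRight.comp (Pi.evalAlgHom (R.obj.obj (op V)) A j)
  have hq : (projTens₂ A i j).toLinearMap ∘ₗ amitsur₀ (R.obj.obj (op V)) (∀ i, A i) =
      ql.toLinearMap - qr.toLinearMap := by
    refine LinearMap.ext fun a => ?_
    rw [LinearMap.comp_apply, amitsur₀_apply, map_sub]
    rfl
  rw [← hu, ← LinearMap.lTensor_comp_apply, hq, LinearMap.lTensor_sub, LinearMap.sub_apply,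
    map_sub, tensEval_lTensor M ρ ql W.hom χ hχ' (hφ W.hom i _ h),
    tensEval_lTensor M ρ qr W.hom χ hχ' (hφ W.hom j _ h')]
  rfl

theorem locally_exists_d₀_eq (hM : IsQuasicoherent M)
    (hA : ∀ i, Algebra.FinitePresentation (R.obj.obj (op V)) (A i))
    (hA' : IsFaithfullyFlat R V (∀ i, A i))
    (c : Maps (prodType (sumPresheaf fun i => Spec R V (A i))
      (sumPresheaf fun i => Spec R V (A i))) M) (hc : d₁ _ M c = 0) :
    ∃ S ∈ J V, ∀ (V' : C) (f : V' ⟶ V), S f →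
      ∃ b : Maps (restr f (sumPresheaf fun i => Spec R V (A i))) M,
        d₀ (restr f (sumPresheaf fun i => Spec R V (A i))) M b = Maps.restrict f c := by
  obtain ⟨S, hS, h⟩ := exists_represents hM hA c
  refine exists_cover_trans ⟨S, hS, fun V₁ f hf => ?_⟩
  obtain ⟨t, ht⟩ := h V₁ f hf
  obtain ⟨S₁, hS₁, h₁⟩ := locally_amitsur₁_eq_zero hM hA hc rfl ht
  refine exists_cover_trans ⟨S₁, hS₁, fun V₂ g hg => ?_⟩
  have hρ : (R.obj.map g.op).hom.comp (R.obj.map f.op).hom = (R.obj.map (g ≫ f).op).hom := by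
    rw [← CommRingCat.hom_comp, ← R.obj.map_comp, ← op_comp]
  obtain ⟨S₂, hS₂, h₂⟩ := exists_amitsur₀_eq M hA' (g ≫ f) _ hρ _ (h₁ V₂ g hg)
  refine ⟨S₂, hS₂, fun V₃ p hp => ?_⟩
  obtain ⟨u, hu⟩ := h₂ V₃ p hp
  have hρ' : (R.obj.map p.op).hom.comp ((R.obj.map g.op).hom.comp (R.obj.map f.op).hom) =
      (R.obj.map ((p ≫ g) ≫ f).op).hom := by
    rw [hρ, ← CommRingCat.hom_comp, ← R.obj.map_comp, ← op_comp, Category.assoc]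
  have ht' := (ht.tensRes g).tensRes p
  rw [← Category.assoc] at ht'
  exact ht'.exists_d₀_eq hρ' u hu

end Cocycles

/-! ### Descent for types that are locally sums of spectra -/

section Descent

variable {C : Type u} [SmallCategory C] {J : GrothendieckTopology C}
  {R : Sheaf J CommRingCat.{u}} {M : Modules R}

theorem d₁_d₀ {V : C} {X : (Over V)ᵒᵖ ⥤ Type u} (b : Maps X M) : d₁ X M (d₀ X M b) = 0 := by
  refine Subtype.ext (funext fun W => funext fun x => ?_)
  change (b.1 W x.1 - b.1 W x.2.1) - (b.1 W x.1 - b.1 W x.2.2) + (b.1 W x.2.1 - b.1 W x.2.2) = 0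
  abel

/-- The cocycle is pulled back to `F` and bounded there. The bounding function extends along `ι`
because `M` is a sheaf, and the equation on `X × X` is tested on `F × F`. -/
theorem locally_exists_d₀_eq_of_locallyBijective {V : C} {F X : (Over V)ᵒᵖ ⥤ Type u} (ι : F ⟶ X)
    [Presheaf.IsLocallyInjective (J.over V) ι] [Presheaf.IsLocallySurjective (J.over V) ι]
    (hF : ∀ c : Maps (prodType F F) M, d₁ F M c = 0 →
      ∃ S ∈ J V, ∀ (V' : C) (f : V' ⟶ V), S f →
        ∃ b : Maps (restr f F) M, d₀ (restr f F) M b = Maps.restrict f c)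
    (c : Maps (prodType X X) M) (hc : d₁ X M c = 0) :
    ∃ S ∈ J V, ∀ (V' : C) (f : V' ⟶ V), S f →
      ∃ b : Maps (restr f X) M, d₀ (restr f X) M b = Maps.restrict f c := by
  let ι₂ : prodType F F ⟶ prodType X X :=
    { app W := ↾fun x => (ι.app W x.1, ι.app W x.2)
      naturality W W' f := by
        refine ConcreteCategory.hom_ext _ _ fun x => ?_
        exact congrArg₂ Prod.mk (NatTrans.naturality_apply ι f x.1)
          (NatTrans.naturality_apply ι f x.2) }
  have hc' : d₁ F M (Maps.precomp ι₂ c) = 0 :=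
    Subtype.ext (funext fun W => funext fun x =>
      congrFun (congrFun (congrArg Subtype.val hc) W)
        (ι.app (op W) x.1, ι.app (op W) x.2.1, ι.app (op W) x.2.2))
  obtain ⟨S, hS, h⟩ := hF _ hc'
  refine ⟨S, hS, fun V' f hf => ?_⟩
  obtain ⟨b, hb⟩ := h V' f hf
  let ι' : restr f F ⟶ restr f X := Functor.whiskerLeft (Over.map f).op ι
  have : Presheaf.IsLocallyInjective (J.over V') ι' :=
    Presheaf.isLocallyInjective_whisker (J.over V') (J.over V) (Over.map f) ι
  have : Presheaf.IsLocallySurjective (J.over V') ι' :=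
    Presheaf.isLocallySurjective_whisker (J.over V') (J.over V) (Over.map f) ι
  obtain ⟨b', rfl⟩ := Maps.exists_precomp_eq ι' b
  exact ⟨b', Maps.eq_of_precomp_eq ι' fun W x x' =>
    congrFun (congrFun (congrArg Subtype.val hb) W) (x, x')⟩

theorem IsFaithfullyFlatAffineSum.locally_exists_d₀_eq (hM : IsQuasicoherent M) {V : C}
    {X : Sheaf (J.over V) (Type u)} (hX : IsFaithfullyFlatAffineSum R X)
    (c : Maps (prodType X.obj X.obj) M) (hc : d₁ X.obj M c = 0) :
    ∃ S ∈ J V, ∀ (V' : C) (f : V' ⟶ V), S f →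
      ∃ b : Maps (restr f X.obj) M, d₀ (restr f X.obj) M b = Maps.restrict f c := by
  obtain ⟨S, hS, h⟩ := hX
  refine exists_cover_trans ⟨S, hS, fun V' f hf => ?_⟩
  obtain ⟨n, A, _, _, hA, hA', ι, _, _⟩ := h V' f hf
  obtain ⟨S', hS', h'⟩ := locally_exists_d₀_eq_of_locallyBijective ι
    (InternalSAG.locally_exists_d₀_eq hM hA hA') (Maps.restrict f c)
    (Subtype.ext (funext fun W => congrFun (congrArg Subtype.val hc) ((Over.map f).obj W)))
  exact ⟨S', hS', fun V'' g hg => Maps.exists_d₀_eq_of_comp f g c (h' V'' g hg)⟩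

theorem d₁_eq_zero_of_locally {V : C} {X : (Over V)ᵒᵖ ⥤ Type u} (c : Maps (prodType X X) M)
    (h : ∃ S ∈ J V, ∀ (V' : C) (f : V' ⟶ V), S f →
      ∃ b : Maps (restr f X) M, d₀ (restr f X) M b = Maps.restrict f c) : d₁ X M c = 0 := by
  obtain ⟨S, hS, h⟩ := h
  refine Maps.eq_of_locally_eq ⟨S, hS, fun V' f hf => ?_⟩
  obtain ⟨b, hb⟩ := h V' f hf
  have := d₁_d₀ b
  rw [hb] at this
  exact this

end Descent

end

end InternalSAG

theorem mainTheorem7 {C : Type u} [SmallCategory C] (J : GrothendieckTopology C)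
    (R : Sheaf J CommRingCat.{u}) (hR : InternalSAG.IsSyntheticAG R)
    (T : InternalSAG.Presentation J)
    (hT : ∀ (V : C) (X : Sheaf (J.over V) (Type u)),
      T.mem X → InternalSAG.IsFaithfullyFlatAffineSum R X)
    (M : InternalSAG.Modules R) (hM : InternalSAG.IsQuasicoherent M) :
    InternalSAG.SatisfiesDescent T M := by
  intro V X hX V' h c
  -- Membership in `T` is stable under restriction, so the argument applies directly at the later
  -- stage `V'`.
  exact ⟨(hT V' _ (T.mem_restrict h X hX)).locally_exists_d₀_eq hM c,
    InternalSAG.d₁_eq_zero_of_locally c⟩
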